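/- Let $\Lambda\ge 1$ be an integer cutoff. Let $\mathcal H_\Lambda$ be the Fock space with orthonormal basis $|0\rangle,\dots,|\Lambda\rangle$, let $a$ be the truncated annihilation operator ($a|m\rangle=\sqrt m\,|m-1\rangle$, $a|0\rangle=0$) and $a^\dagger$ its adjoint. On $\mathbb C^2\otimes\mathcal H_\Lambda$ define, for an integer $k\ge 1$ and $t\in\mathbb R$, $$T_k(t)=\exp\!\left(it\begin{bmatrix}0&(a^\dagger)^k\\ a^k&0\end{bmatrix}\right),\qquad S_1(t)=T_1(t).$$ A circuit is a finite product of exact gates $S_1(s)$, with any $s>0$, and of single-qubit unitaries $U\otimes 1$; its cost is its number of $S_1$ gates. Let $\|\cdot\|$ be the operator norm. Let $k\ge1$ be an integer with $n$ binary digits, let $p>1$ be real, and put $$G(n,p)=n^{1.6}\,30^{np}\,420^{n^2p/2}\,6^{\log_2 n+1}.$$ Then for every cutoff $\Lambda\ge1$ and every $\tau\in\mathbb R$ there is a circuit $W_\Lambda(\tau)$ with at most $G(n,p)$ gates $S_1$, such that the following hold with constants $K$ and $c,C>0$ that depend only on $k$ and $p$. 1. (Order $p$.) $\|T_k(\tau)-W_\Lambda(\tau)\|\le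 K\,(\Lambda^{k/2}|\tau|)^p$ for all $\Lambda\ge 1$ and $\tau\in\mathbb R$. 2. For all $\Lambda\ge1$, $t\in\mathbb R$ and $\varepsilon>0$, put $x=(\Lambda^{k/2}|t|)^{1+1/(p-1)}/\varepsilon^{1/(p-1)}$. There is an integer $r\ge1$ with $c\,x\le r\le\max(1,C\,x)$ (that is, $r\in\Theta(x)$, with at least one slice) such that $$\|T_k(t)-W_\Lambda(t/r)^r\|\le\varepsilon ,$$ and the circuit $W_\Lambda(t/r)^r$ uses at most $r\cdot G(n,p)$ gates $S_1$. -/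

import Mathlib

-- `‖·‖` on complex matrices is the operator norm for the Euclidean (Hilbert space) norm.
open scoped Matrix.Norms.L2Operator

namespace BosonQubit

/-- Operators on (qubit) ⊗ (Fock space with at most `L` bosons), written as `2 × 2` block matrices:
`Sum.inl` is the qubit state `|0⟩`, `Sum.inr` is `|1⟩`, and `Fin (L + 1)` indexes the Fock states
`|0⟩, …, |L⟩`. -/
abbrev Op (L : ℕ) : Type :=
  Matrix (Fin (L + 1) ⊕ Fin (L + 1)) (Fin (L + 1) ⊕ Fin (L + 1)) ℂ

/-- The truncated annihilation operator: `a |m⟩ = √m |m - 1⟩`. -/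
noncomputable def annihilation (L : ℕ) : Matrix (Fin (L + 1)) (Fin (L + 1)) ℂ :=
  Matrix.of fun i j => if (i : ℕ) + 1 = (j : ℕ) then ((Real.sqrt (j : ℕ) : ℝ) : ℂ) else 0

/-- The truncated creation operator `a†`, the adjoint of `a`. -/
noncomputable def creation (L : ℕ) : Matrix (Fin (L + 1)) (Fin (L + 1)) ℂ :=
  (annihilation L).conjTranspose

/-- The Hermitian block encoding `[[0, (a†)^k], [a^k, 0]]`. -/
noncomputable def blockHamiltonian (L k : ℕ) : Op L :=
  Matrix.fromBlocks 0 (creation L ^ k) (annihilation L ^ k) 0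

/-- The target `T_k(t) = exp (i t [[0, (a†)^k], [a^k, 0]])`. -/
noncomputable def target (L k : ℕ) (t : ℝ) : Op L :=
  NormedSpace.exp ((Complex.I * (t : ℂ)) • blockHamiltonian L k)

/-- The gate `S_1(t) = exp (i t [[0, a†], [a, 0]])`. -/
noncomputable def S1 (L : ℕ) (t : ℝ) : Op L :=
  NormedSpace.exp
    ((Complex.I * (t : ℂ)) • (Matrix.fromBlocks 0 (creation L) (annihilation L) 0 : Op L))

/-- A single-qubit operation `U ⊗ 1`. -/
noncomputable def qubitOp (L : ℕ) (U : Matrix (Fin 2) (Fin 2) ℂ) : Op L :=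
  Matrix.fromBlocks (U 0 0 • 1) (U 0 1 • 1) (U 1 0 • 1) (U 1 1 • 1)

/-- Elementary gates: the exact gate `S_1(s)` with `s > 0`, and single-qubit unitaries. -/
inductive Gate : Type
  | s1 (s : ℝ) (hs : 0 < s) : Gate
  | qubit (U : Matrix.unitaryGroup (Fin 2) ℂ) : Gate

namespace Gate

/-- The operator that a gate implements at cutoff `L`. -/
noncomputable def toOp (L : ℕ) : Gate → Op L
  | s1 s _ => S1 L s
  | qubit U => qubitOp L (U : Matrix (Fin 2) (Fin 2) ℂ)

/-- The cost of a gate: `1` for `S_1`, `0` for a single-qubit gate. -/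
def cost : Gate → ℕ
  | s1 _ _ => 1
  | qubit _ => 0

end Gate

/-- A circuit is a finite sequence of gates. -/
abbrev Circuit : Type := List Gate

namespace Circuit

/-- The operator implemented by a circuit: the product of its gates. -/
noncomputable def toOp (L : ℕ) (W : Circuit) : Op L :=
  (W.map (Gate.toOp L)).prod

/-- The number of `S_1` gates in a circuit. -/
def s1Count (W : Circuit) : ℕ :=
  (W.map Gate.cost).sum

/-- The circuit `W` executed `r` times in a row. -/
def repeated (W : Circuit) (r : ℕ) : Circuit :=
  (List.replicate r W).flatten

end Circuit

/-- The number of binary digits of `k`. -/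
def numBinaryDigits (k : ℕ) : ℕ :=
  (Nat.digits 2 k).length

/-- `n^1.6 · 30^(n p) · 420^(n² p / 2) · 6^(log₂ n + 1)`. -/
noncomputable def sliceBound (n : ℕ) (p : ℝ) : ℝ :=
  (n : ℝ) ^ (1.6 : ℝ) * (30 : ℝ) ^ ((n : ℝ) * p) * (420 : ℝ) ^ ((n : ℝ) ^ 2 * p / 2)
    * (6 : ℝ) ^ (Real.logb 2 (n : ℝ) + 1)

/-- The dimensionless evolution time `Λ^(k/2) |t|`. -/
noncomputable def scaledTime (L k : ℕ) (t : ℝ) : ℝ :=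
  (L : ℝ) ^ ((k : ℝ) / 2) * |t|

/-- `(Λ^(k/2) |t|)^(1 + 1/(p-1)) / ε^(1/(p-1))`. -/
noncomputable def sliceScale (L k : ℕ) (t p ε : ℝ) : ℝ :=
  scaledTime L k t ^ (1 + 1 / (p - 1)) / ε ^ (1 / (p - 1))

end BosonQubit

/-! Bracketing the generator of `S_1` with conjugates of itself by qubit unitaries raises the power
of `a†`, the unwanted mixed terms cancelling in pairs. Hence the generator of `T_k` lies in the Lie
algebra of the available generators. Rather than nesting commutator formulas and tracking their
errors, the proof finds the whole word at once by a Lie group argument on formal degrees.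

Tensor each generator, scaled by Λ^(-1/2), with the nilpotent shift of ℂ^(N+1), and treat all
cutoffs together as one element (a letter) of the Banach algebra of bounded families. Normal
ordering, with words of degree above N vanishing, bounds the dimension of the Lie algebra of the
letters by D = 16 (N+1)^4 (`finrank_lieSpan_letter_le`). It contains z = shift^k ⊗ (scaled generator
of `T_k`) (`ladderReachable_sigmaPlus`). For some fixed u > 0, exp(u z) is then exactly a product of
at most D (2 D + 1) exponentials of letters (`exists_wordProd_eq_exp`), one word serving all
cutoffs.

The jet (1, θ, …, θ^N) is an eigenvector of the shift up to an error θ^(N+1). Applying the exact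
identity to it replaces the shift by the number θ, at a cost O(θ^(N+1)) uniform in Λ
(`exists_word_approx`). With u θ^k = Λ^(k/2)|τ| and N + 1 = ⌈k p⌉ this is an error of order p. The
word length is of order (N+1)^8 with N + 1 ≤ 2^n p, so it fits into G(n, p)
(`word_length_le_sliceBound`). For k = 1 the gate itself is exact.

Finally, errors of r slices of contractions add, and r is chosen so that r K (Λ^(k/2)|t|/r)^p ≤ ε
(`exists_slice_count`). -/

set_option linter.unusedSectionVars false

/-! ### Canonical coordinates of the second kind in a Banach algebra -/

namespace ExpWord

open NormedSpace

section Banach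

variable {B : Type*} [NormedRing B] [NormedAlgebra ℝ B] [CompleteSpace B]

theorem exp_mul_exp_neg (x : B) : exp x * exp (-x) = 1 := by
  let _ : NormedAlgebra ℚ B := NormedAlgebra.restrictScalars ℚ ℝ B
  rw [← exp_add_of_commute (Commute.refl x).neg_right]
  simp

theorem exp_neg_mul_exp (x : B) : exp (-x) * exp x = 1 := by
  simpa using exp_mul_exp_neg (-x)

theorem exp_conj_of_mul_eq_one {g g' : B} (h : g * g' = 1) (h' : g' * g = 1) (x : B) :
    exp (g * x * g') = g * exp x * g' := by
  let _ : NormedAlgebra ℚ B := NormedAlgebra.restrictScalars ℚ ℝ B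
  exact exp_units_conj ⟨g, g', h, h'⟩ x

theorem exp_smul_conj_of_mul_eq_one {g g' : B} (h : g * g' = 1) (h' : g' * g = 1) (s : ℝ) (x : B) :
    exp (s • (g * x * g')) = g * exp (s • x) * g' := by
  rw [← exp_conj_of_mul_eq_one h h']
  simp

theorem contDiff_exp_smul (y : B) : ContDiff ℝ 1 fun s : ℝ => exp (s • y) := by
  have h : ContDiff ℝ 1 (exp : B → B) :=
    contDiff_iff_contDiffAt.2 fun x => (exp_analytic (𝕂 := ℝ) x).contDiffAt
  exact h.comp (contDiff_id.smul contDiff_const)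

/-- The product `exp (s 0 • y 0) * exp (s 1 • y 1) * ⋯`: canonical coordinates of the second
kind. -/
noncomputable def secondKind {n : ℕ} (y : Fin n → B) (s : Fin n → ℝ) : B :=
  (List.ofFn fun j => exp (s j • y j)).prod

/-- Forgetting the first coordinate. -/
def tailL (n : ℕ) : (Fin (n + 1) → ℝ) →L[ℝ] (Fin n → ℝ) :=
  ContinuousLinearMap.pi fun i => ContinuousLinearMap.proj i.succ

/-- The right logarithmic derivative of `secondKind y` at `s`. -/
noncomputable def velocity : {n : ℕ} → (Fin n → B) → (Fin n → ℝ) → ((Fin n → ℝ) →L[ℝ] B)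
  | 0, _, _ => 0
  | n + 1, y, s =>
    (ContinuousLinearMap.proj (R := ℝ) (φ := fun _ : Fin (n + 1) => ℝ) 0).smulRight (y 0) +
      (ContinuousLinearMap.mulLeftRight ℝ B (exp (s 0 • y 0)) (exp (-(s 0 • y 0)))).comp
        ((velocity (fun i => y i.succ) (tailL n s)).comp (tailL n))

theorem velocity_succ_apply {n : ℕ} (y : Fin (n + 1) → B) (s v : Fin (n + 1) → ℝ) :
    velocity y s v = v 0 • y 0 + exp (s 0 • y 0) *
      velocity (fun i => y i.succ) (tailL n s) (tailL n v) * exp (-(s 0 • y 0)) := by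
  simp [velocity]

theorem secondKind_succ {n : ℕ} (y : Fin (n + 1) → B) (s : Fin (n + 1) → ℝ) :
    secondKind y s = exp (s 0 • y 0) * secondKind (fun i => y i.succ) (tailL n s) := by
  simp [secondKind, List.ofFn_succ, tailL]

/-- The regularity that Picard–Lindelöf needs in `exists_exp_eq_secondKind`. -/
theorem contDiff_velocity {n : ℕ} (y : Fin n → B) : ContDiff ℝ 1 (velocity y) := by
  induction n with
  | zero => exact contDiff_const
  | succ n ih =>
    have h0 : ContDiff ℝ 1 fun s : Fin (n + 1) → ℝ => s 0 := contDiff_apply ℝ ℝ 0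
    have h1 := (contDiff_exp_smul (y 0)).comp h0
    have h2 := (contDiff_exp_smul (-y 0)).comp h0
    have h3 : ContDiff ℝ 1 fun s : Fin (n + 1) → ℝ =>
        ContinuousLinearMap.mulLeftRight ℝ B (exp (s 0 • y 0)) (exp (-(s 0 • y 0))) := by
      refine ((ContinuousLinearMap.contDiff _).comp h1).clm_apply ?_
      simpa [Function.comp_def] using h2
    exact contDiff_const.add
      (h3.clm_comp (((ih _).comp (tailL n).contDiff).clm_comp contDiff_const))

/-- Product rule: the derivative of each factor is carried to the far left through the factors
before it, which conjugates it by them. -/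
theorem hasDerivAt_secondKind {n : ℕ} (y : Fin n → B) {σ : ℝ → Fin n → ℝ} {σ' : Fin n → ℝ} {u : ℝ}
    (h : HasDerivAt σ σ' u) :
    HasDerivAt (fun u => secondKind y (σ u)) (velocity y (σ u) σ' * secondKind y (σ u)) u := by
  induction n with
  | zero => simpa [secondKind, velocity] using hasDerivAt_const u (1 : B)
  | succ n ih =>
    have h0 : HasDerivAt (fun u => σ u 0) (σ' 0) u := (hasDerivAt_pi.1 h) 0
    have h1 := (hasDerivAt_exp_smul_const' (𝕂 := ℝ) (y 0) (σ u 0)).scomp u h0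
    have h2 := ih (fun i => y i.succ) ((tailL n).hasFDerivAt.comp_hasDerivAt u h)
    have h3 := h1.mul h2
    have e1 : (fun u => secondKind y (σ u)) = ((fun u => exp (u • y 0)) ∘ fun u => σ u 0) *
        fun u => secondKind (fun i => y i.succ) ((⇑(tailL n) ∘ σ) u) :=
      funext fun u => secondKind_succ y (σ u)
    rw [e1]
    refine h3.congr_deriv ?_
    rw [velocity_succ_apply, secondKind_succ]
    simp only [Function.comp_apply, add_mul, smul_mul_assoc, mul_assoc]
    rw [← mul_assoc (exp (-_)) (exp _), exp_neg_mul_exp, one_mul]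

theorem velocity_zero {n : ℕ} (y : Fin n → B) (v : Fin n → ℝ) :
    velocity y 0 v = ∑ j, v j • y j := by
  induction n with
  | zero => simp [velocity]
  | succ n ih =>
    rw [velocity_succ_apply, map_zero, ih, Fin.sum_univ_succ]
    simp [tailL]

theorem velocity_mem {n : ℕ} (y : Fin n → B) (p : Submodule ℝ B) (hy : ∀ j, y j ∈ p)
    (hp : ∀ j, ∀ s : ℝ, ∀ z ∈ p, exp (s • y j) * z * exp (-(s • y j)) ∈ p) (s v : Fin n → ℝ) :
    velocity y s v ∈ p := by
  induction n with
  | zero => simp [velocity]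
  | succ n ih =>
    rw [velocity_succ_apply]
    exact p.add_mem (p.smul_mem _ (hy 0))
      (hp 0 _ _ (ih _ (fun j => hy j.succ) (fun j => hp j.succ) _ _))

/-- Canonical coordinates of the second kind reach every direction of the span, provided that the
span is stable under conjugation by the one-parameter groups involved. -/
theorem exists_exp_eq_secondKind {n : ℕ} (y : Fin n → B) (hli : LinearIndependent ℝ y)
    (hp : ∀ j, ∀ s : ℝ, ∀ z ∈ Submodule.span ℝ (Set.range y),
      exp (s • y j) * z * exp (-(s • y j)) ∈ Submodule.span ℝ (Set.range y))
    {h : B} (hh : h ∈ Submodule.span ℝ (Set.range y)) :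
    ∃ u : ℝ, 0 < u ∧ ∀ r ∈ Set.Icc 0 u, ∃ s : Fin n → ℝ, exp (r • h) = secondKind y s := by
  set p := Submodule.span ℝ (Set.range y) with hpdef
  have : FiniteDimensional ℝ p := FiniteDimensional.span_of_finite ℝ (Set.finite_range y)
  let b : Module.Basis (Fin n) ℝ p := Module.Basis.span hli
  -- `π` reads off coordinates on the span, so that "velocity equals `h`" becomes a square linear
  -- system for the derivative of the coordinates.
  obtain ⟨π, hπ⟩ := ContinuousLinearMap.exist_extension_of_finiteDimensional_range
    (S := p) (LinearMap.toContinuousLinearMap (b.equivFun : p →ₗ[ℝ] (Fin n → ℝ)))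
  have hπ' : ∀ z (hz : z ∈ p), π z = b.equivFun ⟨z, hz⟩ := fun z hz => by
    have := congrArg (fun f => f ⟨z, hz⟩) hπ
    simpa using this.symm
  have hinj : ∀ z ∈ p, ∀ w ∈ p, π z = π w → z = w := fun z hz w hw e => by
    rw [hπ' z hz, hπ' w hw] at e
    simpa using b.equivFun.injective e
  have hy : ∀ j, y j ∈ p := fun j => Submodule.subset_span ⟨j, rfl⟩
  let A : (Fin n → ℝ) → ((Fin n → ℝ) →L[ℝ] (Fin n → ℝ)) := fun s => π.comp (velocity y s)
  have hA : ContDiff ℝ 1 A := contDiff_const.clm_comp (contDiff_velocity y)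
  have hA0 : A 0 = 1 := by
    ext1 v
    have hm : velocity y 0 v ∈ p := velocity_mem y p hy hp 0 v
    have e : (⟨velocity y 0 v, hm⟩ : p) = b.equivFun.symm v := by
      refine Subtype.ext ((velocity_zero y v).trans ?_)
      rw [Module.Basis.equivFun_symm_apply]
      simp only [AddSubmonoidClass.coe_finsetSum, Submodule.coe_smul]
      exact Finset.sum_congr rfl fun j _ => congrArg (fun z : p => v j • (z : B)) (Module.Basis.span_apply hli j).symm
    simp only [A, ContinuousLinearMap.comp_apply]
    rw [hπ' _ hm, e, LinearEquiv.apply_symm_apply]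
    rfl
  -- The field solving `A s (V s) = π h`. `Ring.inverse` is meaningful only where `A s` is a unit;
  -- this holds near 0 because `A 0 = 1`.
  let V : (Fin n → ℝ) → (Fin n → ℝ) := fun s => Ring.inverse (A s) (π h)
  have hV : ContDiffAt ℝ 1 V 0 := by
    have h1 : ContDiffAt ℝ 1 Ring.inverse (A 0) := by
      rw [hA0]
      exact contDiffAt_ringInverse ℝ (1 : ((Fin n → ℝ) →L[ℝ] (Fin n → ℝ))ˣ)
    exact (h1.comp 0 hA.contDiffAt).clm_apply contDiffAt_const
  obtain ⟨ρ, hρ, ε, hε, hsol⟩ :=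
    hV.exists_forall_mem_closedBall_exists_eq_forall_mem_Ioo_hasDerivAt 0
  obtain ⟨σ, hσ0, hσ⟩ := hsol 0 (Metric.mem_closedBall_self hρ.le)
  have hunit : ∀ᶠ u in nhds (0 : ℝ), IsUnit (A (σ u)) := by
    have hc : ContinuousAt (fun u => A (σ u)) 0 :=
      hA.continuous.continuousAt.comp (hσ 0 (by constructor <;> linarith)).continuousAt
    refine hc.eventually ?_
    simp only [hσ0, hA0]
    exact Units.isOpen.mem_nhds isUnit_one
  obtain ⟨δ, hδ, hδu⟩ := Metric.eventually_nhds_iff.1 hunit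
  refine ⟨min (ε / 2) (δ / 2), by positivity, fun r hr => ⟨σ r, ?_⟩⟩
  have hder : ∀ u ∈ Set.Icc 0 r, HasDerivAt (fun u => secondKind y (σ u))
      (h * secondKind y (σ u)) u := by
    intro u hu
    have hu1 : u ≤ ε / 2 := hu.2.trans (hr.2.trans (min_le_left _ _))
    have hu2 : u ≤ δ / 2 := hu.2.trans (hr.2.trans (min_le_right _ _))
    have hU := hδu (y := u) (by rw [Real.dist_eq, sub_zero, abs_of_nonneg hu.1]; linarith)
    have hd := hasDerivAt_secondKind y (hσ u ⟨by linarith [hu.1], by linarith⟩)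
    have e : velocity y (σ u) (V (σ u)) = h := by
      refine hinj _ (velocity_mem y p hy hp _ _) _ hh ?_
      change (A (σ u) * Ring.inverse (A (σ u))) (π h) = π h
      rw [Ring.mul_inverse_cancel _ hU]
      rfl
    rwa [e] at hd
  -- Both sides solve g' = h g with g 0 = 1, so exp(-u h) times the product is constant.
  have hG : ∀ u ∈ Set.Icc 0 r,
      HasDerivAt (fun u => exp (u • (-h)) * secondKind y (σ u)) 0 u := by
    intro u hu
    have := (hasDerivAt_exp_smul_const (𝕂 := ℝ) (-h) u).mul (hder u hu)
    refine this.congr_deriv ?_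
    simp [mul_assoc]
  have hconst := constant_of_has_deriv_right_zero
    (fun u hu => (hG u hu).continuousAt.continuousWithinAt)
    (fun u hu => (hG u ⟨hu.1, hu.2.le⟩).hasDerivWithinAt) r ⟨hr.1, le_rfl⟩
  have h0 : secondKind y (σ 0) = 1 := by
    simp [secondKind, hσ0]
  simp only [zero_smul, exp_zero, h0, mul_one] at hconst
  have := congrArg (exp (r • h) * ·) hconst
  simp only [← mul_assoc, smul_neg, exp_mul_exp_neg, one_mul, mul_one] at this
  exact this.symm

end Banach

end ExpWord

/-! ### Words in one-parameter groups and the Lie algebra they reach -/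

namespace ExpWord

open NormedSpace

section Words

variable {B : Type*} [NormedRing B] [NormedAlgebra ℝ B] [CompleteSpace B] {I : Type*} (x : I → B)

/-- The product of the exponentials `exp (s • x i)` over the letters `(s, i)` of a word. -/
noncomputable def wordProd (w : List (ℝ × I)) : B :=
  (w.map fun q => exp (q.1 • x q.2)).prod

/-- The formal inverse of a word. -/
def wordInv (w : List (ℝ × I)) : List (ℝ × I) :=
  (w.map fun q => (-q.1, q.2)).reverse

/-- Conjugation by the product of a word. -/
noncomputable def conj (w : List (ℝ × I)) (z : B) : B :=
  wordProd x w * z * wordProd x (wordInv w)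

theorem wordProd_cons (q : ℝ × I) (w : List (ℝ × I)) :
    wordProd x (q :: w) = exp (q.1 • x q.2) * wordProd x w := by
  simp [wordProd]

theorem wordProd_append (v w : List (ℝ × I)) :
    wordProd x (v ++ w) = wordProd x v * wordProd x w := by
  simp [wordProd]

theorem wordInv_cons (q : ℝ × I) (w : List (ℝ × I)) :
    wordInv (q :: w) = wordInv w ++ [(-q.1, q.2)] := by
  simp [wordInv]

theorem wordInv_wordInv (w : List (ℝ × I)) : wordInv (wordInv w) = w := by
  simp [wordInv, Function.comp_def]

theorem wordInv_append (v w : List (ℝ × I)) : wordInv (v ++ w) = wordInv w ++ wordInv v := by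
  simp [wordInv]

theorem length_wordInv (w : List (ℝ × I)) : (wordInv w).length = w.length := by
  simp [wordInv]

theorem wordProd_mul_wordProd_wordInv (w : List (ℝ × I)) :
    wordProd x w * wordProd x (wordInv w) = 1 := by
  induction w with
  | nil => simp [wordProd, wordInv]
  | cons q w ih =>
    rw [wordProd_cons, wordInv_cons, wordProd_append, mul_assoc,
      ← mul_assoc (wordProd x w), ih, one_mul]
    simpa [wordProd] using exp_mul_exp_neg (q.1 • x q.2)

theorem wordProd_wordInv_mul_wordProd (w : List (ℝ × I)) :
    wordProd x (wordInv w) * wordProd x w = 1 := by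
  simpa [wordInv_wordInv] using wordProd_mul_wordProd_wordInv x (wordInv w)

theorem conj_nil (z : B) : conj x [] z = z := by
  simp [conj, wordProd, wordInv]

theorem conj_append (v w : List (ℝ × I)) (z : B) : conj x (v ++ w) z = conj x v (conj x w z) := by
  simp only [conj, wordProd_append, wordInv_append, mul_assoc]

theorem conj_add (w : List (ℝ × I)) (y z : B) : conj x w (y + z) = conj x w y + conj x w z := by
  simp [conj, mul_add, add_mul]

theorem conj_smul (w : List (ℝ × I)) (c : ℝ) (z : B) : conj x w (c • z) = c • conj x w z := by
  simp [conj]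

theorem conj_zero (w : List (ℝ × I)) : conj x w (0 : B) = 0 := by
  simp [conj]

/-- The word of the one-parameter group generated by `conj x w (x i)`. -/
def conjWord (w : List (ℝ × I)) (s : ℝ) (i : I) : List (ℝ × I) :=
  w ++ ((s, i) :: wordInv w)

theorem wordProd_conjWord (w : List (ℝ × I)) (s : ℝ) (i : I) :
    wordProd x (conjWord w s i) = exp (s • conj x w (x i)) := by
  rw [conj, exp_smul_conj_of_mul_eq_one (wordProd_mul_wordProd_wordInv x w)
    (wordProd_wordInv_mul_wordProd x w), conjWord, wordProd_append, wordProd_cons, mul_assoc]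

theorem conj_conjWord (w : List (ℝ × I)) (s : ℝ) (i : I) (z : B) :
    conj x (conjWord w s i) z =
      exp (s • conj x w (x i)) * z * exp (-(s • conj x w (x i))) := by
  have : wordInv (conjWord w s i) = conjWord w (-s) i := by
    simp [conjWord, wordInv_append, wordInv_cons, wordInv_wordInv]
  rw [conj, this, wordProd_conjWord, wordProd_conjWord, neg_smul]

theorem length_conjWord (w : List (ℝ × I)) (s : ℝ) (i : I) :
    (conjWord w s i).length = 2 * w.length + 1 := by
  simp [conjWord, length_wordInv]
  ring

/-- The span of the conjugates of the letters by words of length at most `m`. -/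
noncomputable def orbitSpan (m : ℕ) : Submodule ℝ B :=
  Submodule.span ℝ {z | ∃ (w : List (ℝ × I)) (i : I), w.length ≤ m ∧ conj x w (x i) = z}

/-- The span of all conjugates of the letters by words. -/
noncomputable def lieSpan : Submodule ℝ B :=
  Submodule.span ℝ {z | ∃ (w : List (ℝ × I)) (i : I), conj x w (x i) = z}

theorem orbitSpan_mono {m n : ℕ} (h : m ≤ n) : orbitSpan x m ≤ orbitSpan x n :=
  Submodule.span_mono fun _ ⟨w, i, hw, e⟩ => ⟨w, i, hw.trans h, e⟩

theorem orbitSpan_le_lieSpan (m : ℕ) : orbitSpan x m ≤ lieSpan x :=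
  Submodule.span_mono fun _ ⟨w, i, _, e⟩ => ⟨w, i, e⟩

theorem conj_singleton_mem_orbitSpan {m : ℕ} (q : ℝ × I) {z : B} (hz : z ∈ orbitSpan x m) :
    conj x [q] z ∈ orbitSpan x (m + 1) := by
  induction hz using Submodule.span_induction with
  | mem z hz =>
    obtain ⟨w, i, hw, rfl⟩ := hz
    rw [← conj_append]
    exact Submodule.subset_span ⟨_, i, by simpa using hw, rfl⟩
  | zero => rw [conj_zero]; exact zero_mem _
  | add y z _ _ hy hz => rw [conj_add]; exact add_mem hy hz
  | smul c z _ hz => rw [conj_smul]; exact Submodule.smul_mem _ c hz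

theorem conj_mem_lieSpan (w : List (ℝ × I)) {z : B} (hz : z ∈ lieSpan x) :
    conj x w z ∈ lieSpan x := by
  induction hz using Submodule.span_induction with
  | mem z hz =>
    obtain ⟨v, i, rfl⟩ := hz
    rw [← conj_append]
    exact Submodule.subset_span ⟨_, i, rfl⟩
  | zero => rw [conj_zero]; exact zero_mem _
  | add y z _ _ hy hz => rw [conj_add]; exact add_mem hy hz
  | smul c z _ hz => rw [conj_smul]; exact Submodule.smul_mem _ c hz

theorem letter_mem_orbitSpan (m : ℕ) (i : I) : x i ∈ orbitSpan x m :=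
  Submodule.subset_span ⟨[], i, Nat.zero_le _, conj_nil x _⟩

theorem letter_mem_lieSpan (i : I) : x i ∈ lieSpan x :=
  orbitSpan_le_lieSpan x 0 (letter_mem_orbitSpan x 0 i)

/-- Prepending a letter costs one unit of length. Once the chain stalls, its term is stable under
every letter, hence under every word. -/
theorem lieSpan_le_orbitSpan_of_eq {m : ℕ} (h : orbitSpan x (m + 1) = orbitSpan x m) :
    lieSpan x ≤ orbitSpan x m := by
  refine Submodule.span_le.2 ?_
  rintro _ ⟨w, i, rfl⟩
  induction w with
  | nil => rw [conj_nil]; exact letter_mem_orbitSpan x m i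
  | cons q w ih =>
    have := conj_singleton_mem_orbitSpan x q ih
    rwa [h, ← conj_append] at this

/-- The chain grows by at least one dimension at each step until it stalls, so words of length `D`
suffice. -/
theorem orbitSpan_eq_lieSpan [FiniteDimensional ℝ (lieSpan x)] {D : ℕ}
    (hD : Module.finrank ℝ (lieSpan x) ≤ D) : orbitSpan x D = lieSpan x := by
  refine le_antisymm (orbitSpan_le_lieSpan x D) ?_
  have key : ∀ m, lieSpan x ≤ orbitSpan x m ∨ m ≤ Module.finrank ℝ (orbitSpan x m) := by
    intro m
    induction m with
    | zero => exact Or.inr (Nat.zero_le _)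
    | succ m ih =>
      rcases ih with ih | ih
      · exact Or.inl (ih.trans (orbitSpan_mono x m.le_succ))
      · by_cases h : orbitSpan x (m + 1) = orbitSpan x m
        · exact Or.inl ((lieSpan_le_orbitSpan_of_eq x h).trans (orbitSpan_mono x m.le_succ))
        · right
          have : FiniteDimensional ℝ (orbitSpan x (m + 1)) :=
            Submodule.finiteDimensional_of_le (orbitSpan_le_lieSpan x _)
          have hlt : orbitSpan x m < orbitSpan x (m + 1) :=
            lt_of_le_of_ne (orbitSpan_mono x m.le_succ) (Ne.symm h)
          exact Nat.succ_le_of_lt (ih.trans_lt (Submodule.finrank_lt_finrank_of_lt hlt))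
  rcases key D with h | h
  · exact h
  · refine (Submodule.eq_of_le_of_finrank_le (orbitSpan_le_lieSpan x D) (hD.trans h)).ge

/-- Every direction of the Lie algebra generated by the letters is reached by words of length
quadratic in its dimension. -/
theorem exists_wordProd_eq_exp [FiniteDimensional ℝ (lieSpan x)] {D : ℕ}
    (hD : Module.finrank ℝ (lieSpan x) ≤ D) {h : B} (hh : h ∈ lieSpan x) :
    ∃ u : ℝ, 0 < u ∧ ∀ r ∈ Set.Icc 0 u, ∃ w : List (ℝ × I),
      w.length ≤ D * (2 * D + 1) ∧ exp (r • h) = wordProd x w := by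
  have hspan := orbitSpan_eq_lieSpan x hD
  have hfin : FiniteDimensional ℝ (orbitSpan x D) := by rw [hspan]; infer_instance
  have hrank : Module.finrank ℝ (orbitSpan x D) ≤ D := by rw [hspan]; exact hD
  unfold orbitSpan at hspan hfin hrank
  -- A basis made of conjugates of letters: the one-parameter group of each basis vector is itself a
  -- word.
  obtain ⟨y, hy, hyspan, hli⟩ := Submodule.exists_fun_fin_finrank_span_eq ℝ
    {z | ∃ (w : List (ℝ × I)) (i : I), w.length ≤ D ∧ conj x w (x i) = z}
  choose w i hw hyw using hy
  replace hyspan := hyspan.trans hspan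
  obtain ⟨u, hu, hU⟩ := exists_exp_eq_secondKind y hli (h := h) (fun j s z hz => by
    rw [hyspan] at hz ⊢
    rw [← hyw j, ← conj_conjWord]
    exact conj_mem_lieSpan x _ hz) (by rwa [hyspan])
  refine ⟨u, hu, fun r hr => ?_⟩
  obtain ⟨s, hs⟩ := hU r hr
  -- At most `D` basis vectors, each contributing a conjugating word of length at most `D`, one
  -- letter, and the inverse word.
  refine ⟨(List.ofFn fun j => conjWord (w j) (s j) (i j)).flatten, ?_, ?_⟩
  · rw [List.length_flatten, List.map_ofFn, List.sum_ofFn]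
    calc ∑ j, (List.length ∘ fun j => conjWord (w j) (s j) (i j)) j
        ≤ ∑ _j : Fin _, (2 * D + 1) := Finset.sum_le_sum fun j _ => by
          simp only [Function.comp_apply, length_conjWord]
          have := hw j
          omega
      _ ≤ D * (2 * D + 1) := by
          simp only [Finset.sum_const, Finset.card_univ, Fintype.card_fin, smul_eq_mul]
          exact Nat.mul_le_mul_right _ hrank
  · rw [hs, secondKind, wordProd, List.map_flatten, List.prod_flatten, List.map_map, List.map_ofFn]
    congr 2
    funext j
    rw [← hyw j, ← wordProd_conjWord]
    rfl

/-- The commutator is the derivative at 0 of a conjugation that preserves the span, and a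
finite-dimensional span is closed. -/
theorem commutator_mem_lieSpan [FiniteDimensional ℝ (lieSpan x)] {y z : B} (hy : y ∈ lieSpan x)
    (hz : z ∈ lieSpan x) : y * z - z * y ∈ lieSpan x := by
  induction hy using Submodule.span_induction with
  | mem y hy =>
    obtain ⟨w, i, rfl⟩ := hy
    set y := conj x w (x i)
    have hd : HasDerivAt (fun s : ℝ => exp (s • y) * z * exp (s • (-y))) (y * z - z * y) 0 := by
      have h1 := ((hasDerivAt_exp_smul_const (𝕂 := ℝ) y 0).mul_const z).mul
        (hasDerivAt_exp_smul_const (𝕂 := ℝ) (-y) 0)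
      refine h1.congr_deriv ?_
      simp [sub_eq_add_neg]
    have hmem : ∀ s : ℝ, exp (s • y) * z * exp (s • (-y)) ∈ lieSpan x := fun s => by
      rw [smul_neg, ← conj_conjWord]
      exact conj_mem_lieSpan x _ hz
    refine (Submodule.closed_of_finiteDimensional (lieSpan x)).mem_of_tendsto hd.tendsto_slope
      (Filter.Eventually.of_forall fun s => ?_)
    exact Submodule.smul_mem _ _ (sub_mem (hmem s) (hmem 0))
  | zero => simp
  | add a b _ _ ha hb =>
    have : (a + b) * z - z * (a + b) = (a * z - z * a) + (b * z - z * b) := by noncomm_ring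
    rw [this]
    exact add_mem ha hb
  | smul c a _ ha =>
    rw [smul_mul_assoc, mul_smul_comm, ← smul_sub]
    exact Submodule.smul_mem _ c ha

theorem exp_mul_mem (S : Submodule ℝ B) [FiniteDimensional ℝ S] {y : B}
    (hy : ∀ z ∈ S, y * z ∈ S) {z : B} (hz : z ∈ S) : exp y * z ∈ S := by
  have hs := (exp_series_hasSum_exp' (𝕂 := ℝ) y).mul_right z
  refine (Submodule.closed_of_finiteDimensional S).mem_of_tendsto hs
    (Filter.Eventually.of_forall fun s => ?_)
  refine sum_mem fun n hn => ?_
  clear hn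
  rw [smul_mul_assoc]
  refine S.smul_mem _ ?_
  induction n with
  | zero => simpa using hz
  | succ n ih => rw [pow_succ', mul_assoc]; exact hy _ ih

theorem wordProd_mul_mem (S : Submodule ℝ B) [FiniteDimensional ℝ S]
    (hx : ∀ i, ∀ z ∈ S, x i * z ∈ S) (w : List (ℝ × I)) {z : B} (hz : z ∈ S) :
    wordProd x w * z ∈ S := by
  induction w with
  | nil => simpa [wordProd] using hz
  | cons q w ih =>
    rw [wordProd_cons, mul_assoc]
    refine exp_mul_mem S (fun z hz => ?_) ih
    rw [smul_mul_assoc]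
    exact S.smul_mem _ (hx _ _ hz)

/-- Each conjugate of a letter arises from 1 by left multiplications only, so stability under left
multiplication by letters already bounds the Lie algebra. -/
theorem lieSpan_le (S : Submodule ℝ B) [FiniteDimensional ℝ S] (h1 : (1 : B) ∈ S)
    (hx : ∀ i, ∀ z ∈ S, x i * z ∈ S) : lieSpan x ≤ S := by
  refine Submodule.span_le.2 ?_
  rintro _ ⟨w, i, rfl⟩
  have := wordProd_mul_mem x S hx w (hx i _ (wordProd_mul_mem x S hx (wordInv w) h1))
  simpa [conj, mul_assoc] using this

end Words

end ExpWord

/-! ### Intertwining estimates and the jet of the nilpotent shift -/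

namespace Truncation

open NormedSpace Matrix
open scoped Kronecker

section Norms

variable {m n : Type*} [Fintype m] [DecidableEq m] [Fintype n] [DecidableEq n]

theorem norm_le_one_of_conjTranspose_mul_self {E : Matrix m n ℂ} (h : Eᴴ * E = 1) : ‖E‖ ≤ 1 := by
  have h1 := l2_opNorm_conjTranspose_mul_self E
  rw [h] at h1
  have h2 : ‖(1 : Matrix n n ℂ)‖ ≤ 1 := by
    rw [← diagonal_one, l2_opNorm_diagonal]
    exact (pi_norm_le_iff_of_nonneg zero_le_one).2 fun i => by simp
  nlinarith [norm_nonneg E]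

theorem norm_pow_mul_sub_mul_pow_le (P : Matrix m m ℂ) (Q : Matrix n n ℂ) (E : Matrix m n ℂ)
    {b δ : ℝ} (hb : 1 ≤ b) (hP : ‖P‖ ≤ b) (hQ : ‖Q‖ ≤ b) (hE : ‖P * E - E * Q‖ ≤ δ) (j : ℕ) :
    ‖P ^ j * E - E * Q ^ j‖ ≤ j * b ^ j * δ := by
  have hδ : 0 ≤ δ := (norm_nonneg _).trans hE
  have hQpow : ∀ j : ℕ, ‖(P * E - E * Q) * Q ^ j‖ ≤ b ^ j * δ := by
    intro j
    induction j with
    | zero => simpa using hE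
    | succ j ih =>
      rw [pow_succ, ← Matrix.mul_assoc]
      calc _ ≤ ‖(P * E - E * Q) * Q ^ j‖ * ‖Q‖ := l2_opNorm_mul _ _
        _ ≤ (b ^ j * δ) * b := mul_le_mul ih hQ (norm_nonneg _) (by positivity)
        _ = _ := by ring
  induction j with
  | zero => simp
  | succ j ih =>
    have e : P ^ (j + 1) * E - E * Q ^ (j + 1) =
        P * (P ^ j * E - E * Q ^ j) + (P * E - E * Q) * Q ^ j := by
      rw [pow_succ', pow_succ', Matrix.mul_sub, Matrix.sub_mul]
      simp only [Matrix.mul_assoc]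
      abel
    rw [e]
    calc _ ≤ ‖P‖ * ‖P ^ j * E - E * Q ^ j‖ + ‖(P * E - E * Q) * Q ^ j‖ :=
          (norm_add_le _ _).trans (add_le_add_left (l2_opNorm_mul _ _) _)
      _ ≤ b * (j * b ^ j * δ) + b ^ j * δ :=
          add_le_add (mul_le_mul hP ih (norm_nonneg _) (by positivity)) (hQpow j)
      _ ≤ b * (j * b ^ j * δ) + b * (b ^ j * δ) := by
          have : 0 ≤ b ^ j * δ := by positivity
          nlinarith
      _ = _ := by push_cast; ring

theorem norm_exp_mul_sub_mul_exp_le (P : Matrix m m ℂ) (Q : Matrix n n ℂ) (E : Matrix m n ℂ)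
    {b δ : ℝ} (hb : 1 ≤ b) (hP : ‖P‖ ≤ b) (hQ : ‖Q‖ ≤ b) (hE : ‖P * E - E * Q‖ ≤ δ) :
    ‖exp P * E - E * exp Q‖ ≤ Real.exp (2 * b) * δ := by
  have hδ : 0 ≤ δ := (norm_nonneg _).trans hE
  have h1 := (exp_series_hasSum_exp' (𝕂 := ℂ) P).map
    (AddMonoidHom.mk' (fun M : Matrix m m ℂ => M * E) fun _ _ => Matrix.add_mul _ _ _)
    (continuous_id.matrix_mul continuous_const)
  have h2 := (exp_series_hasSum_exp' (𝕂 := ℂ) Q).map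
    (AddMonoidHom.mk' (fun M : Matrix n n ℂ => E * M) fun _ _ => Matrix.mul_add _ _ _)
    (continuous_const.matrix_mul continuous_id)
  have h3 : HasSum (fun j : ℕ => ((j.factorial : ℝ)⁻¹ * (2 * b) ^ j) * δ)
      (Real.exp (2 * b) * δ) := by
    have := (exp_series_hasSum_exp' (𝕂 := ℝ) (2 * b)).mul_right δ
    rw [← Real.exp_eq_exp_ℝ] at this
    simpa using this
  refine HasSum.norm_le_of_bounded (h1.sub h2) h3 fun j => ?_
  simp only [Function.comp_apply, AddMonoidHom.mk'_apply, Matrix.smul_mul, Matrix.mul_smul,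
    ← smul_sub]
  rw [norm_smul, mul_assoc]
  have hn : ‖((j.factorial : ℂ))⁻¹‖ = (j.factorial : ℝ)⁻¹ := by simp
  rw [hn]
  refine mul_le_mul_of_nonneg_left ?_ (by positivity)
  refine (norm_pow_mul_sub_mul_pow_le P Q E hb hP hQ hE j).trans ?_
  refine mul_le_mul_of_nonneg_right ?_ hδ
  rw [mul_pow]
  refine mul_le_mul_of_nonneg_right ?_ (by positivity)
  -- The factor j from telescoping is absorbed by j ≤ 2^j, whence the exponent 2b.
  exact_mod_cast (Nat.lt_two_pow_self (n := j)).le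

end Norms

section Kronecker

variable {κ : Type*} [Fintype κ] [DecidableEq κ] (N : ℕ)

/-- The nilpotent shift on `ℂ ^ (N + 1)`. -/
def shift : Matrix (Fin (N + 1)) (Fin (N + 1)) ℂ :=
  of fun r c => if (r : ℕ) + 1 = c then 1 else 0

theorem shift_pow_apply (j : ℕ) (r c : Fin (N + 1)) :
    (shift N ^ j) r c = if (r : ℕ) + j = c then 1 else 0 := by
  induction j generalizing r with
  | zero => simp [Matrix.one_apply, Fin.ext_iff]
  | succ j ih =>
    rw [pow_succ', Matrix.mul_apply]
    have hs : ∀ a b, shift N a b = if (a : ℕ) + 1 = b then 1 else 0 := fun _ _ => rfl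
    simp only [hs, ih, ite_mul, one_mul, zero_mul]
    by_cases h : (r : ℕ) + 1 < N + 1
    · rw [Finset.sum_eq_single ⟨r + 1, h⟩]
      · simp only [if_true]
        congr 1
        simp only [eq_iff_iff]
        omega
      · intro b _ hb
        rw [if_neg fun e => hb (Fin.ext e.symm)]
      · simp
    · have : ¬ (r : ℕ) + (j + 1) = c := by omega
      rw [if_neg this]
      exact Finset.sum_eq_zero fun b _ => if_neg (by omega)

theorem shift_pow_eq_zero {j : ℕ} (h : N < j) : shift N ^ j = 0 := by
  ext r c
  rw [shift_pow_apply, Matrix.zero_apply, if_neg (by omega)]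

variable {N}

/-- The inclusion of the `r`-th summand of `ℂ ^ (N + 1) ⊗ ℂ ^ κ`. -/
def incl (κ : Type*) [DecidableEq κ] (r : Fin (N + 1)) : Matrix (Fin (N + 1) × κ) κ ℂ :=
  of fun p j => if p.1 = r then (1 : Matrix κ κ ℂ) p.2 j else 0

theorem incl_conjTranspose_mul_incl (r c : Fin (N + 1)) :
    (incl κ r)ᴴ * incl κ c = if r = c then 1 else 0 := by
  ext i j
  rw [Matrix.mul_apply, Fintype.sum_prod_type]
  by_cases h : r = c
  · subst h
    simp [incl, Matrix.one_apply, apply_ite]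
    split_ifs with h <;> simp [h, eq_comm]
  · have h' : ¬ c = r := fun e => h e.symm
    simp [incl, h, Matrix.one_apply, apply_ite]
    exact fun e => absurd e h'

theorem norm_incl_le (r : Fin (N + 1)) : ‖incl κ r‖ ≤ 1 :=
  norm_le_one_of_conjTranspose_mul_self (by rw [incl_conjTranspose_mul_incl, if_pos rfl])

theorem kronecker_eq_sum (K : Matrix (Fin (N + 1)) (Fin (N + 1)) ℂ) (X : Matrix κ κ ℂ) :
    K ⊗ₖ X = ∑ r, ∑ c, K r c • (incl κ r * X * (incl κ c)ᴴ) := by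
  ext ⟨r, i⟩ ⟨c, j⟩
  have h : ∀ r' c' : Fin (N + 1), (incl κ r' * X * (incl κ c')ᴴ) (r, i) (c, j) =
      if r = r' ∧ c = c' then X i j else 0 := by
    intro r' c'
    by_cases h1 : r = r' <;> by_cases h2 : c = c' <;>
      simp [incl, Matrix.mul_apply, Matrix.one_apply, h1, h2, apply_ite]
  simp only [kroneckerMap_apply, Matrix.sum_apply, Matrix.smul_apply, h]
  rw [Finset.sum_eq_single r, Finset.sum_eq_single c]
  · simp
  · intro b _ hb
    simp [Ne.symm hb]
  · simp
  · intro b _ hb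
    simp [Ne.symm hb]
  · simp

/-- Crude, but the constant depends on `K` alone and not on `κ`, hence not on the cutoff. -/
theorem norm_kronecker_le (K : Matrix (Fin (N + 1)) (Fin (N + 1)) ℂ) (X : Matrix κ κ ℂ) :
    ‖K ⊗ₖ X‖ ≤ (∑ r, ∑ c, ‖K r c‖) * ‖X‖ := by
  rw [kronecker_eq_sum, Finset.sum_mul]
  refine (norm_sum_le _ _).trans (Finset.sum_le_sum fun r _ => ?_)
  rw [Finset.sum_mul]
  refine (norm_sum_le _ _).trans (Finset.sum_le_sum fun c _ => ?_)
  rw [norm_smul]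
  refine mul_le_mul_of_nonneg_left ?_ (norm_nonneg _)
  have h1 : ‖(incl κ c)ᴴ‖ ≤ 1 := by
    rw [l2_opNorm_conjTranspose]
    exact norm_incl_le c
  calc _ ≤ ‖incl κ r * X‖ * ‖(incl κ c)ᴴ‖ := l2_opNorm_mul _ _
    _ ≤ (‖incl κ r‖ * ‖X‖) * 1 :=
        mul_le_mul (l2_opNorm_mul _ _) h1 (norm_nonneg _) (by positivity)
    _ ≤ (1 * ‖X‖) * 1 := by gcongr; exact norm_incl_le r
    _ = ‖X‖ := by ring

/-- The approximate eigenvector `(1, θ, …, θ ^ N)` of the shift, tensored with the identity. -/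
noncomputable def jet (N : ℕ) (κ : Type*) [DecidableEq κ] (θ : ℝ) :
    Matrix (Fin (N + 1) × κ) κ ℂ :=
  of fun p j => (θ : ℂ) ^ (p.1 : ℕ) * (1 : Matrix κ κ ℂ) p.2 j

/-- The zeroth entry of the jet is θ^0 = 1. This left inverse of norm at most 1 removes the jet in
`norm_sub_le_of_jet`. -/
theorem incl_zero_conjTranspose_mul_jet (θ : ℝ) : (incl κ (0 : Fin (N + 1)))ᴴ * jet N κ θ = 1 := by
  ext i j
  rw [Matrix.mul_apply, Fintype.sum_prod_type]
  simp [incl, jet, Matrix.one_apply, apply_ite]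
  split_ifs with h <;> simp [h, eq_comm]

theorem one_kronecker_mul_jet (X : Matrix κ κ ℂ) (θ : ℝ) :
    ((1 : Matrix (Fin (N + 1)) (Fin (N + 1)) ℂ) ⊗ₖ X) * jet N κ θ = jet N κ θ * X := by
  ext ⟨r, i⟩ j
  rw [Matrix.mul_apply, Matrix.mul_apply, Fintype.sum_prod_type]
  simp [jet, Matrix.one_apply, kroneckerMap_apply, mul_comm]

/-- The eigenvector equation fails only in the last entry, where the shift has no θ^(N+1) to bring
in. -/
theorem shift_kronecker_one_mul_jet (θ : ℝ) :
    (shift N ⊗ₖ (1 : Matrix κ κ ℂ)) * jet N κ θ - jet N κ θ * ((θ : ℂ) • (1 : Matrix κ κ ℂ)) =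
      -((θ : ℂ) ^ (N + 1)) • incl κ (Fin.last N) := by
  ext ⟨r, i⟩ j
  rw [Matrix.sub_apply, Matrix.mul_apply, Fintype.sum_prod_type]
  have h1 : ∀ (c : Fin (N + 1)), ∑ l : κ, (shift N ⊗ₖ (1 : Matrix κ κ ℂ)) (r, i) (c, l) *
      jet N κ θ (c, l) j = if (r : ℕ) + 1 = c then (θ : ℂ) ^ (c : ℕ) * (1 : Matrix κ κ ℂ) i j
        else 0 := by
    intro c
    by_cases h : (r : ℕ) + 1 = c <;> simp [jet, shift, kroneckerMap_apply, Matrix.one_apply, h]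
  rw [Finset.sum_congr rfl fun c _ => h1 c]
  rw [Matrix.mul_smul, Matrix.mul_one]
  simp only [Matrix.smul_apply, incl, jet, of_apply, smul_eq_mul]
  by_cases h : (r : ℕ) + 1 < N + 1
  · rw [Finset.sum_eq_single ⟨r + 1, h⟩]
    · have : r ≠ Fin.last N := fun e => by rw [e] at h; simp at h
      simp only [if_true, this, if_false]
      ring
    · intro b _ hb
      rw [if_neg fun e => hb (Fin.ext e.symm)]
    · simp
  · have hr : r = Fin.last N := Fin.ext (by simp; omega)
    rw [Finset.sum_eq_zero fun b _ => if_neg (by omega), if_pos hr, hr]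
    simp only [Fin.val_last]
    ring

theorem norm_shift_kronecker_one_mul_jet_le {θ : ℝ} (h0 : 0 ≤ θ) :
    ‖(shift N ⊗ₖ (1 : Matrix κ κ ℂ)) * jet N κ θ - jet N κ θ * ((θ : ℂ) • (1 : Matrix κ κ ℂ))‖ ≤
      θ ^ (N + 1) := by
  rw [shift_kronecker_one_mul_jet, norm_smul]
  calc _ ≤ ‖-((θ : ℂ) ^ (N + 1))‖ * 1 := by gcongr; exact norm_incl_le _
    _ = θ ^ (N + 1) := by
      rw [mul_one, norm_neg, norm_pow, Complex.norm_real, Real.norm_of_nonneg h0]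

theorem norm_one_le : ‖(1 : Matrix κ κ ℂ)‖ ≤ 1 :=
  norm_le_one_of_conjTranspose_mul_self (by simp)

/-- The jet intertwines `shift ^ j ⊗ X` and `θ ^ j X` up to an error of order `θ ^ (N + 1)`. -/
theorem exists_norm_shift_pow_kronecker_mul_jet_le (N j : ℕ) :
    ∃ C : ℝ, 0 ≤ C ∧ ∀ (κ : Type) [Fintype κ] [DecidableEq κ] (X : Matrix κ κ ℂ) (θ : ℝ),
      0 ≤ θ → θ ≤ 1 →
      ‖((shift N ^ j) ⊗ₖ X) * jet N κ θ - jet N κ θ * ((θ : ℂ) ^ j • X)‖ ≤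
        C * ‖X‖ * θ ^ (N + 1) := by
  induction j with
  | zero => exact ⟨0, le_rfl, fun κ _ _ X θ _ _ => by simp [one_kronecker_mul_jet]⟩
  | succ j ih =>
    obtain ⟨C, hC, h⟩ := ih
    set S := ∑ r, ∑ c, ‖shift N r c‖
    have hS : 0 ≤ S := Finset.sum_nonneg fun _ _ => Finset.sum_nonneg fun _ _ => norm_nonneg _
    refine ⟨S * C + 1, by positivity, fun κ _ _ X θ h0 h1 => ?_⟩
    set P := shift N ⊗ₖ (1 : Matrix κ κ ℂ)
    have hP : ‖P‖ ≤ S := by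
      refine (norm_kronecker_le _ _).trans ?_
      exact mul_le_of_le_one_right hS norm_one_le
    have e : ((shift N ^ (j + 1)) ⊗ₖ X) * jet N κ θ - jet N κ θ * ((θ : ℂ) ^ (j + 1) • X) =
        P * (((shift N ^ j) ⊗ₖ X) * jet N κ θ - jet N κ θ * ((θ : ℂ) ^ j • X)) +
        (P * jet N κ θ - jet N κ θ * ((θ : ℂ) • (1 : Matrix κ κ ℂ))) * ((θ : ℂ) ^ j • X) := by
      have : (shift N ^ (j + 1)) ⊗ₖ X = P * ((shift N ^ j) ⊗ₖ X) := by
        rw [← Matrix.mul_kronecker_mul, pow_succ', one_mul]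
      rw [this, Matrix.mul_sub, Matrix.sub_mul]
      simp only [Matrix.mul_assoc, Matrix.smul_mul, Matrix.mul_smul, Matrix.one_mul, smul_smul]
      rw [pow_succ (θ : ℂ), mul_comm (_ ^ j) (θ : ℂ)]
      simp only [sub_add_sub_cancel]
    rw [e]
    have hθ : ‖(θ : ℂ) ^ j • X‖ ≤ ‖X‖ := by
      rw [norm_smul, norm_pow, Complex.norm_real, Real.norm_of_nonneg h0]
      exact mul_le_of_le_one_left (norm_nonneg _) (pow_le_one₀ h0 h1)
    calc _ ≤ ‖P‖ * ‖((shift N ^ j) ⊗ₖ X) * jet N κ θ - jet N κ θ * ((θ : ℂ) ^ j • X)‖ +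
          ‖P * jet N κ θ - jet N κ θ * ((θ : ℂ) • (1 : Matrix κ κ ℂ))‖ * ‖(θ : ℂ) ^ j • X‖ :=
          (norm_add_le _ _).trans (add_le_add (l2_opNorm_mul _ _) (l2_opNorm_mul _ _))
      _ ≤ S * (C * ‖X‖ * θ ^ (N + 1)) + θ ^ (N + 1) * ‖X‖ :=
          add_le_add (mul_le_mul hP (h κ X θ h0 h1) (norm_nonneg _) hS)
            (mul_le_mul (norm_shift_kronecker_one_mul_jet_le h0) hθ (norm_nonneg _)
              (by positivity))
      _ = _ := by ring

end Kronecker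

end Truncation

/-! ### Operators on qubit ⊗ Fock space and their cutoff-uniform norms -/

namespace BosonQubit

open NormedSpace Matrix Truncation
open scoped Kronecker ENNReal

/-- The tensor product of a qubit operator and a Fock space operator. -/
def tens {L : ℕ} (α : Matrix (Fin 2) (Fin 2) ℂ) (Y : Matrix (Fin (L + 1)) (Fin (L + 1)) ℂ) :
    Op L :=
  fromBlocks (α 0 0 • Y) (α 0 1 • Y) (α 1 0 • Y) (α 1 1 • Y)

section Tens

variable {L : ℕ} (α β : Matrix (Fin 2) (Fin 2) ℂ) (Y Z : Matrix (Fin (L + 1)) (Fin (L + 1)) ℂ)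

theorem tens_mul_tens : tens α Y * tens β Z = tens (α * β) (Y * Z) := by
  simp only [tens, fromBlocks_multiply, Matrix.mul_apply, Fin.sum_univ_two, Matrix.smul_mul,
    Matrix.mul_smul, smul_smul, add_smul, mul_comm (β _ _)]

theorem tens_add_left : tens (α + β) Y = tens α Y + tens β Y := by
  simp only [tens, fromBlocks_add, Matrix.add_apply, add_smul]

theorem tens_add_right : tens α (Y + Z) = tens α Y + tens α Z := by
  simp only [tens, fromBlocks_add, smul_add]

theorem tens_smul_left (c : ℂ) : tens (c • α) Y = c • tens α Y := by
  simp only [tens, fromBlocks_smul, Matrix.smul_apply, smul_smul, smul_eq_mul]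

theorem tens_smul_right (c : ℂ) : tens α (c • Y) = c • tens α Y := by
  simp only [tens, fromBlocks_smul, smul_smul, mul_comm]

theorem tens_neg_left : tens (-α) Y = -tens α Y := by
  simpa using tens_smul_left α Y (-1)

theorem tens_sub_left : tens (α - β) Y = tens α Y - tens β Y := by
  rw [sub_eq_add_neg, tens_add_left, tens_neg_left, sub_eq_add_neg]

theorem tens_one_one : tens 1 (1 : Matrix (Fin (L + 1)) (Fin (L + 1)) ℂ) = 1 := by
  simp [tens, fromBlocks_one]

theorem tens_conjTranspose : (tens α Y)ᴴ = tens αᴴ Yᴴ := by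
  simp [tens, fromBlocks_conjTranspose]

end Tens

theorem qubitOp_eq_tens (L : ℕ) (U : Matrix (Fin 2) (Fin 2) ℂ) : qubitOp L U = tens U 1 := rfl

theorem norm_qubitOp_le (L : ℕ) (U : Matrix.unitaryGroup (Fin 2) ℂ) :
    ‖qubitOp L (U : Matrix (Fin 2) (Fin 2) ℂ)‖ ≤ 1 := by
  refine norm_le_one_of_conjTranspose_mul_self ?_
  have h : (U : Matrix (Fin 2) (Fin 2) ℂ)ᴴ * U = 1 := (Matrix.mem_unitaryGroup_iff'.1 U.2)
  rw [qubitOp_eq_tens, tens_conjTranspose, tens_mul_tens, h, conjTranspose_one, one_mul,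
    tens_one_one]

/-- The raising operator `|0⟩⟨1|` of the qubit. -/
def sigmaPlus : Matrix (Fin 2) (Fin 2) ℂ := !![0, 1; 0, 0]

/-- The operator `α ⊗ (a†) ^ j + α† ⊗ a ^ j`. -/
noncomputable def ladder (L j : ℕ) (α : Matrix (Fin 2) (Fin 2) ℂ) : Op L :=
  tens α (creation L ^ j) + tens αᴴ (annihilation L ^ j)

theorem conjTranspose_annihilation (L : ℕ) : (annihilation L)ᴴ = creation L := rfl

theorem conjTranspose_creation (L : ℕ) : (creation L)ᴴ = annihilation L :=
  conjTranspose_conjTranspose _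

theorem blockHamiltonian_eq_ladder (L k : ℕ) : blockHamiltonian L k = ladder L k sigmaPlus := by
  simp [blockHamiltonian, ladder, tens, sigmaPlus, fromBlocks_add]

theorem ladder_isHermitian (L j : ℕ) (α : Matrix (Fin 2) (Fin 2) ℂ) :
    (ladder L j α)ᴴ = ladder L j α := by
  simp only [ladder, conjTranspose_add, tens_conjTranspose, conjTranspose_pow,
    conjTranspose_annihilation, conjTranspose_creation, conjTranspose_conjTranspose]
  exact add_comm _ _

theorem annihilation_apply (L : ℕ) (i j : Fin (L + 1)) : annihilation L i j =
    if (i : ℕ) + 1 = (j : ℕ) then ((Real.sqrt (j : ℕ) : ℝ) : ℂ) else 0 := rfl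

theorem creation_apply (L : ℕ) (i j : Fin (L + 1)) : creation L i j =
    if (j : ℕ) + 1 = (i : ℕ) then ((Real.sqrt (i : ℕ) : ℝ) : ℂ) else 0 := by
  rw [creation, conjTranspose_apply, annihilation_apply]
  split_ifs <;> simp

theorem creation_mul_annihilation (L : ℕ) :
    creation L * annihilation L = diagonal fun m : Fin (L + 1) => ((m : ℕ) : ℂ) := by
  ext i j
  simp only [Matrix.mul_apply, creation_apply, annihilation_apply, diagonal_apply]
  by_cases hij : i = j
  · subst hij
    rw [if_pos rfl]
    obtain ⟨m, hm⟩ := i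
    rcases m with _ | m
    · simp
    · rw [Finset.sum_eq_single ⟨m, by omega⟩]
      · simp only [if_true]
        rw [← Complex.ofReal_mul, Real.mul_self_sqrt (Nat.cast_nonneg _)]
        simp
      · intro b _ hb
        rw [if_neg, zero_mul]
        intro h
        exact hb (Fin.ext (by simpa using h))
      · simp
  · rw [if_neg hij]
    refine Finset.sum_eq_zero fun b _ => ?_
    by_cases h1 : (b : ℕ) + 1 = i
    · rw [if_neg (c := (b : ℕ) + 1 = j), mul_zero]
      exact fun h2 => hij (Fin.ext (h1.symm.trans h2))
    · rw [if_neg h1, zero_mul]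

theorem annihilation_mul_creation (L : ℕ) :
    annihilation L * creation L =
      diagonal fun m : Fin (L + 1) => if (m : ℕ) + 1 ≤ L then (((m : ℕ) + 1 : ℕ) : ℂ) else 0 := by
  ext i j
  simp only [Matrix.mul_apply, creation_apply, annihilation_apply, diagonal_apply]
  by_cases hij : i = j
  · subst hij
    rw [if_pos rfl]
    by_cases hL : (i : ℕ) + 1 ≤ L
    · rw [Finset.sum_eq_single ⟨i + 1, by omega⟩]
      · simp only [if_true, hL]
        rw [← Complex.ofReal_mul, Real.mul_self_sqrt (Nat.cast_nonneg _)]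
        simp
      · intro b _ hb
        rw [if_neg, zero_mul]
        exact fun h => hb (Fin.ext h.symm)
      · simp
    · rw [if_neg hL]
      exact Finset.sum_eq_zero fun b _ => by rw [if_neg (by omega), zero_mul]
  · rw [if_neg hij]
    refine Finset.sum_eq_zero fun b _ => ?_
    by_cases h1 : (i : ℕ) + 1 = b
    · rw [if_neg (c := (j : ℕ) + 1 = b), mul_zero]
      exact fun h2 => hij (Fin.ext (by omega))
    · rw [if_neg h1, zero_mul]

/-- The square of this Hermitian operator is diagonal, with entries between 0 and `L`. -/
theorem norm_blockHamiltonian_one_le (L : ℕ) : ‖blockHamiltonian L 1‖ ≤ Real.sqrt L := by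
  have h : ‖(blockHamiltonian L 1)ᴴ * blockHamiltonian L 1‖ ≤ L := by
    have e : (blockHamiltonian L 1)ᴴ * blockHamiltonian L 1 = diagonal (Sum.elim
        (fun m : Fin (L + 1) => ((m : ℕ) : ℂ))
        (fun m : Fin (L + 1) => if (m : ℕ) + 1 ≤ L then (((m : ℕ) + 1 : ℕ) : ℂ) else 0)) := by
      simp [blockHamiltonian, fromBlocks_conjTranspose, conjTranspose_creation,
        conjTranspose_annihilation, fromBlocks_multiply, creation_mul_annihilation,
        annihilation_mul_creation, fromBlocks_diagonal]
    rw [e, l2_opNorm_diagonal, pi_norm_le_iff_of_nonneg (Nat.cast_nonneg _)]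
    rintro (m | m)
    · simp only [Sum.elim_inl, Complex.norm_natCast]
      exact_mod_cast Nat.lt_succ_iff.1 m.2
    · simp only [Sum.elim_inr]
      split_ifs with h
      · rw [Complex.norm_natCast]
        exact_mod_cast h
      · simp
  rw [l2_opNorm_conjTranspose_mul_self] at h
  exact Real.le_sqrt_of_sq_le (by nlinarith)

theorem norm_blockHamiltonian_le (L k : ℕ) : ‖blockHamiltonian L k‖ ≤ Real.sqrt L ^ k := by
  -- The qubit flip turns the first-order Hamiltonian into diag(a†, a), whose powers are block
  -- diagonal; a second flip restores the off-diagonal form.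
  set X : Op L := fromBlocks 0 1 1 0
  have hX : ‖X‖ ≤ 1 := norm_le_one_of_conjTranspose_mul_self (by
    simp [X, fromBlocks_conjTranspose, fromBlocks_multiply, fromBlocks_one])
  have e1 : ∀ k, (fromBlocks (creation L) 0 0 (annihilation L) : Op L) ^ k =
      fromBlocks (creation L ^ k) 0 0 (annihilation L ^ k) := by
    intro k
    induction k with
    | zero => simp [fromBlocks_one]
    | succ k ih => rw [pow_succ, ih, fromBlocks_multiply]; simp [pow_succ]
  have e2 : (fromBlocks (creation L) 0 0 (annihilation L) : Op L) = blockHamiltonian L 1 * X := by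
    simp [blockHamiltonian, X, fromBlocks_multiply]
  have e3 : blockHamiltonian L k = (blockHamiltonian L 1 * X) ^ k * X := by
    rw [← e2, e1]
    simp [blockHamiltonian, X, fromBlocks_multiply]
  have h1 : ‖blockHamiltonian L 1 * X‖ ≤ Real.sqrt L :=
    (norm_mul_le _ _).trans ((mul_le_mul (norm_blockHamiltonian_one_le L) hX (norm_nonneg _)
      (Real.sqrt_nonneg _)).trans_eq (mul_one _))
  have h2 : ‖(blockHamiltonian L 1 * X) ^ k‖ ≤ Real.sqrt L ^ k := by
    induction k with
    | zero => simp
    | succ k ih =>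
      rw [pow_succ, pow_succ]
      refine (norm_mul_le _ _).trans (mul_le_mul (ih ?_) h1 (norm_nonneg _) (by positivity))
      rw [← e2, e1]
      simp [blockHamiltonian, X, fromBlocks_multiply]
  rw [e3]
  exact (norm_mul_le _ _).trans ((mul_le_mul h2 hX (norm_nonneg _) (by positivity)).trans_eq
    (mul_one _))

/-- Operators with an additional register that records the formal degree. -/
abbrev BigOp (N L : ℕ) : Type :=
  Matrix (Fin (N + 1) × (Fin (L + 1) ⊕ Fin (L + 1))) (Fin (N + 1) × (Fin (L + 1) ⊕ Fin (L + 1))) ℂ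

/-- Bounded families of operators, one for each cutoff. -/
abbrev Fam (N : ℕ) : Type := lp (fun L : ℕ => BigOp N L) ∞

/-- The anti-Hermitian generator `i Λ^(-1/2) U (σ₊ a† + σ₋ a) U†`. -/
noncomputable def letterOp (L : ℕ) (U : Matrix.unitaryGroup (Fin 2) ℂ) : Op L :=
  (Complex.I * (((Real.sqrt L)⁻¹ : ℝ) : ℂ)) •
    (qubitOp L (U : Matrix (Fin 2) (Fin 2) ℂ) * blockHamiltonian L 1 *
      qubitOp L ((star U : Matrix.unitaryGroup (Fin 2) ℂ) : Matrix (Fin 2) (Fin 2) ℂ))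

theorem norm_letterOp_le (L : ℕ) (U : Matrix.unitaryGroup (Fin 2) ℂ) : ‖letterOp L U‖ ≤ 1 := by
  rw [letterOp, norm_smul, norm_mul, Complex.norm_I, one_mul, Complex.norm_real,
    Real.norm_of_nonneg (inv_nonneg.2 (Real.sqrt_nonneg _))]
  have h : ‖qubitOp L (U : Matrix (Fin 2) (Fin 2) ℂ) * blockHamiltonian L 1 *
      qubitOp L ((star U : Matrix.unitaryGroup (Fin 2) ℂ) : Matrix (Fin 2) (Fin 2) ℂ)‖ ≤
      Real.sqrt L := by
    calc _ ≤ (‖qubitOp L (U : Matrix (Fin 2) (Fin 2) ℂ)‖ * ‖blockHamiltonian L 1‖) *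
          ‖qubitOp L ((star U : Matrix.unitaryGroup (Fin 2) ℂ) : Matrix (Fin 2) (Fin 2) ℂ)‖ :=
          (norm_mul_le _ _).trans (mul_le_mul_of_nonneg_right (norm_mul_le _ _) (norm_nonneg _))
      _ ≤ (1 * Real.sqrt L) * 1 := by
          gcongr
          · exact norm_qubitOp_le L U
          · exact norm_blockHamiltonian_one_le L
          · exact norm_qubitOp_le L (star U)
      _ = Real.sqrt L := by ring
  exact (mul_le_mul_of_nonneg_left h (inv_nonneg.2 (Real.sqrt_nonneg _))).trans inv_mul_le_one

/-- The family `shift ⊗ letterOp`: a generator, marked as being of degree one. -/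
noncomputable def letter (N : ℕ) (U : Matrix.unitaryGroup (Fin 2) ℂ) : Fam N :=
  ⟨fun L => shift N ⊗ₖ letterOp L U, memℓp_infty ⟨∑ r, ∑ c, ‖shift N r c‖, by
    rintro _ ⟨L, rfl⟩
    refine (norm_kronecker_le _ _).trans ?_
    exact mul_le_of_le_one_right (Finset.sum_nonneg fun _ _ => Finset.sum_nonneg fun _ _ =>
      norm_nonneg _) (norm_letterOp_le L U)⟩⟩

theorem letter_apply (N : ℕ) (U : Matrix.unitaryGroup (Fin 2) ℂ) (L : ℕ) :
    letter N U L = shift N ⊗ₖ letterOp L U := rfl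

/-- The operator `i Λ^(-j/2) (α ⊗ (a†) ^ j + α† ⊗ a ^ j)`. -/
noncomputable def skewLadder (L j : ℕ) (α : Matrix (Fin 2) (Fin 2) ℂ) : Op L :=
  (Complex.I * (((Real.sqrt L)⁻¹ : ℝ) : ℂ) ^ j) • ladder L j α

theorem ladder_add (L j : ℕ) (α β : Matrix (Fin 2) (Fin 2) ℂ) :
    ladder L j (α + β) = ladder L j α + ladder L j β := by
  simp only [ladder, conjTranspose_add, tens_add_left]
  abel

theorem ladder_smul (L j : ℕ) (c : ℝ) (α : Matrix (Fin 2) (Fin 2) ℂ) :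
    ladder L j ((c : ℂ) • α) = (c : ℂ) • ladder L j α := by
  simp only [ladder, conjTranspose_smul, tens_smul_left, smul_add, Complex.star_def,
    Complex.conj_ofReal]

theorem letterOp_eq_skewLadder (L : ℕ) (U : Matrix.unitaryGroup (Fin 2) ℂ) :
    letterOp L U = skewLadder L 1 ((U : Matrix (Fin 2) (Fin 2) ℂ) * sigmaPlus *
      (U : Matrix (Fin 2) (Fin 2) ℂ)ᴴ) := by
  rw [letterOp, skewLadder, pow_one, blockHamiltonian_eq_ladder]
  congr 1
  simp only [ladder, qubitOp_eq_tens, mul_add, add_mul, tens_mul_tens, one_mul, mul_one,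
    conjTranspose_mul, conjTranspose_conjTranspose, mul_assoc]
  rfl

/-- The cross terms of the commutators cancel in pairs. -/
theorem skewLadder_commutator (L j : ℕ) (α β : Matrix (Fin 2) (Fin 2) ℂ) :
    (skewLadder L j α * skewLadder L 1 β - skewLadder L 1 β * skewLadder L j α) +
      (skewLadder L j (Complex.I • α) * skewLadder L 1 (-Complex.I • β) -
        skewLadder L 1 (-Complex.I • β) * skewLadder L j (Complex.I • α)) =
      skewLadder L (j + 1) ((2 * Complex.I) • (α * β - β * α)) := by
  have hI : Complex.I * Complex.I = -1 := Complex.I_mul_I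
  -- Replacing (α, β) by (iα, -iβ) multiplies αβ by 1 but αβ† by i·i = -1, so pure terms double and
  -- mixed terms cancel.
  simp only [skewLadder, ladder, Matrix.smul_mul, Matrix.mul_smul, add_mul, mul_add,
    tens_mul_tens, tens_smul_left, conjTranspose_smul, conjTranspose_sub, conjTranspose_mul,
    tens_sub_left, smul_add, smul_sub, smul_smul, ← pow_succ, ← pow_succ', pow_one]
  simp only [Complex.star_def, map_neg, map_mul, Complex.conj_I, neg_neg, map_ofNat, pow_succ]
  generalize (((Real.sqrt L)⁻¹ : ℝ) : ℂ) = c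
  match_scalars
  all_goals
    ring_nf
    simp only [Complex.I_sq, Complex.I_pow_four]
    try ring

end BosonQubit

/-! ### Normal ordering and a dimension bound independent of the cutoff -/

namespace BosonQubit

open NormedSpace Matrix Truncation
open scoped Kronecker ENNReal

/-- The operator `f (a†a)`. -/
def diagOp (L : ℕ) (f : ℤ → ℂ) : Matrix (Fin (L + 1)) (Fin (L + 1)) ℂ :=
  diagonal fun m => f (m : ℕ)

theorem diagOp_mul_diagOp (L : ℕ) (f g : ℤ → ℂ) :
    diagOp L f * diagOp L g = diagOp L fun m => f m * g m := by
  simp [diagOp]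

theorem diagOp_mul_creation (L : ℕ) (f : ℤ → ℂ) :
    diagOp L f * creation L = creation L * diagOp L fun m => f (m + 1) := by
  ext i j
  simp only [diagOp, diagonal_mul, mul_diagonal, creation_apply]
  split_ifs with h
  · rw [← h, mul_comm]
    push_cast
    rfl
  · simp

theorem diagOp_mul_annihilation (L : ℕ) (f : ℤ → ℂ) :
    diagOp L f * annihilation L = annihilation L * diagOp L fun m => f (m - 1) := by
  ext i j
  simp only [diagOp, diagonal_mul, mul_diagonal, annihilation_apply]
  split_ifs with h
  · rw [← h, mul_comm]
    push_cast
    rw [add_sub_cancel_right]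
  · simp

theorem diagOp_mul_creation_pow (L : ℕ) (f : ℤ → ℂ) (j : ℕ) :
    diagOp L f * creation L ^ j = creation L ^ j * diagOp L fun m => f (m + j) := by
  induction j with
  | zero => simp
  | succ j ih =>
    rw [pow_succ, ← mul_assoc, ih, mul_assoc, diagOp_mul_creation, ← mul_assoc]
    congr 2
    funext m
    congr 1
    push_cast
    ring

theorem diagOp_mul_annihilation_pow (L : ℕ) (f : ℤ → ℂ) (j : ℕ) :
    diagOp L f * annihilation L ^ j = annihilation L ^ j * diagOp L fun m => f (m - j) := by
  induction j with
  | zero => simp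
  | succ j ih =>
    rw [pow_succ, ← mul_assoc, ih, mul_assoc, diagOp_mul_annihilation, ← mul_assoc]
    congr 2
    funext m
    congr 1
    push_cast
    ring

/-- The operator `(a†) ^ j P_h (a†a) ^ i` or `a ^ j P_h (a†a) ^ i`, where `P_h` projects onto the
Fock states with at most `L - h` bosons. -/
noncomputable def normalForm (b : Bool) (j h i L : ℕ) : Matrix (Fin (L + 1)) (Fin (L + 1)) ℂ :=
  (bif b then creation L else annihilation L) ^ j *
    diagOp L fun m => if m + h ≤ L then (m : ℂ) ^ i else 0

/-- The only contraction is a† a^(j+1) = a^j (a†a - j), exact even after truncation. In the other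
cases one term suffices, and `t = 0` makes the second a filler. -/
theorem creation_mul_normalForm (b : Bool) {j h i d : ℕ} (hj : j ≤ d) (hh : h ≤ d) (hi : i ≤ d) :
    ∃ (b' : Bool) (j' h' i' i'' : ℕ) (t : ℝ), j' ≤ d + 1 ∧ h' ≤ d + 1 ∧ i' ≤ d + 1 ∧ i'' ≤ d + 1 ∧
      ∀ L, creation L * normalForm b j h i L =
        normalForm b' j' h' i' L + t • normalForm b' j' h' i'' L := by
  cases b with
  | true =>
    refine ⟨true, j + 1, h, i, 0, 0, by omega, by omega, by omega, by omega, fun L => ?_⟩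
    rw [zero_smul, add_zero, normalForm, normalForm, ← mul_assoc, cond_true, ← pow_succ']
  | false =>
    cases j with
    | zero =>
      refine ⟨true, 1, h, i, 0, 0, by omega, by omega, by omega, by omega, fun L => ?_⟩
      rw [zero_smul, add_zero, normalForm, normalForm, pow_zero, one_mul, pow_one, cond_true]
    | succ j =>
      refine ⟨false, j, h, i + 1, i, -j, by omega, by omega, by omega, by omega, fun L => ?_⟩
      have e : creation L * annihilation L = diagOp L fun m => (m : ℂ) := by
        rw [creation_mul_annihilation]
        simp [diagOp]
      simp only [normalForm, cond_false]
      rw [pow_succ', ← mul_assoc, ← mul_assoc, e, diagOp_mul_annihilation_pow, mul_assoc,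
        diagOp_mul_diagOp, ← Matrix.mul_smul, ← mul_add]
      congr 1
      ext p q
      simp only [diagOp, Matrix.add_apply, Matrix.smul_apply, diagonal_apply]
      split_ifs
      · simp only [Complex.real_smul]
        push_cast
        ring
      · simp
      · simp

/-- Truncation makes a a† vanish on the top state, so a (a†)^(j+1) = (a†)^j P_(j+1) (a†a + j + 1).
This is why the projections are needed; they combine by P_h P_(j+1) = P_(max h (j+1)). -/
theorem annihilation_mul_normalForm (b : Bool) {j h i d : ℕ} (hj : j ≤ d) (hh : h ≤ d)
    (hi : i ≤ d) :
    ∃ (b' : Bool) (j' h' i' i'' : ℕ) (t : ℝ), j' ≤ d + 1 ∧ h' ≤ d + 1 ∧ i' ≤ d + 1 ∧ i'' ≤ d + 1 ∧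
      ∀ L, annihilation L * normalForm b j h i L =
        normalForm b' j' h' i' L + t • normalForm b' j' h' i'' L := by
  cases b with
  | false =>
    refine ⟨false, j + 1, h, i, 0, 0, by omega, by omega, by omega, by omega, fun L => ?_⟩
    rw [zero_smul, add_zero, normalForm, normalForm, ← mul_assoc, cond_false, ← pow_succ']
  | true =>
    cases j with
    | zero =>
      refine ⟨false, 1, h, i, 0, 0, by omega, by omega, by omega, by omega, fun L => ?_⟩
      rw [zero_smul, add_zero, normalForm, normalForm, pow_zero, one_mul, pow_one, cond_false]
    | succ j =>
      refine ⟨true, j, max h (j + 1), i + 1, i, j + 1, by omega, by omega, by omega, by omega,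
        fun L => ?_⟩
      have e : annihilation L * creation L =
          diagOp L fun m => if m + 1 ≤ L then (m : ℂ) + 1 else 0 := by
        rw [annihilation_mul_creation, diagOp]
        congr 1
        funext m
        have : (((m : ℕ) : ℤ) + 1 ≤ (L : ℤ)) ↔ (m : ℕ) + 1 ≤ L := by omega
        simp [this]
      simp only [normalForm, cond_true]
      rw [pow_succ', ← mul_assoc, ← mul_assoc, e, diagOp_mul_creation_pow, mul_assoc,
        diagOp_mul_diagOp, ← Matrix.mul_smul, ← mul_add]
      congr 1
      ext p q
      simp only [diagOp, Matrix.add_apply, Matrix.smul_apply, diagonal_apply]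
      by_cases hpq : p = q
      · simp only [hpq, if_true]
        by_cases h1 : ((q : ℕ) : ℤ) + j + 1 ≤ L <;> by_cases h2 : ((q : ℕ) : ℤ) + h ≤ L
        · rw [if_pos h1, if_pos h2, if_pos (by push_cast; omega), if_pos (by push_cast; omega)]
          simp only [Complex.real_smul]
          push_cast
          ring
        all_goals
          rw [if_neg (c := ((q : ℕ) : ℤ) + (max h (j + 1) : ℕ) ≤ L) (by push_cast; omega),
            if_neg (c := ((q : ℕ) : ℤ) + (max h (j + 1) : ℕ) ≤ L) (by push_cast; omega)]
          simp [h1, h2]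
      · simp [hpq]

/-- Words of degree `d` are combinations of these families. -/
noncomputable def wordFamily (N d : ℕ) (α : Matrix (Fin 2) (Fin 2) ℂ) (b : Bool) (j h i : ℕ) :
    ∀ L, BigOp N L := fun L =>
  (shift N ^ d) ⊗ₖ tens α (((((Real.sqrt L)⁻¹ : ℝ) : ℂ) ^ d) • normalForm b j h i L)

/-- The span of all words. -/
noncomputable def wordSpan (N : ℕ) : Submodule ℝ (∀ L, BigOp N L) :=
  Submodule.span ℝ {M | ∃ d α b j h i, j ≤ d ∧ h ≤ d ∧ i ≤ d ∧ M = wordFamily N d α b j h i}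

/-- A finite spanning family of `wordSpan`. -/
noncomputable def wordBasis (N : ℕ) :
    (Fin (N + 1) × Fin (N + 1) × Fin (N + 1) × Fin (N + 1)) × (Fin 2 × Fin 2) × Bool × Bool →
      ∀ L, BigOp N L := fun q =>
  wordFamily N q.1.1 (single q.2.1.1 q.2.1.2 (bif q.2.2.1 then Complex.I else 1)) q.2.2.2
    q.1.2.1 q.1.2.2.1 q.1.2.2.2

theorem wordFamily_add (N d : ℕ) (α β : Matrix (Fin 2) (Fin 2) ℂ) (b : Bool) (j h i : ℕ) :
    wordFamily N d (α + β) b j h i = wordFamily N d α b j h i + wordFamily N d β b j h i := by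
  funext L
  simp only [wordFamily, tens_add_left, kronecker_add, Pi.add_apply]

theorem wordFamily_smul (N d : ℕ) (c : ℝ) (α : Matrix (Fin 2) (Fin 2) ℂ) (b : Bool) (j h i : ℕ) :
    wordFamily N d (c • α) b j h i = c • wordFamily N d α b j h i := by
  funext L
  rw [← Complex.coe_smul c α]
  simp only [wordFamily, tens_smul_left, kronecker_smul, Pi.smul_apply]
  simp only [Complex.coe_smul]

/-- Degrees above `N` vanish with the power of the shift. As scalars are real, each matrix entry is
split into its real and imaginary parts. -/
theorem wordSpan_le_span_range (N : ℕ) :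
    wordSpan N ≤ Submodule.span ℝ (Set.range (wordBasis N)) := by
  refine Submodule.span_le.2 ?_
  rintro _ ⟨d, α, b, j, h, i, hj, hh, hi, rfl⟩
  by_cases hd : d ≤ N
  · have key : ∀ μ ν, wordFamily N d (single μ ν (α μ ν)) b j h i ∈
        Submodule.span ℝ (Set.range (wordBasis N)) := by
      intro μ ν
      have e : single μ ν (α μ ν) = (α μ ν).re • single μ ν 1 + (α μ ν).im • single μ ν Complex.I := by
        rw [smul_single, smul_single, ← single_add]
        congr 1
        simp
      rw [e, wordFamily_add, wordFamily_smul, wordFamily_smul]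
      refine add_mem (Submodule.smul_mem _ _ (Submodule.subset_span ?_))
        (Submodule.smul_mem _ _ (Submodule.subset_span ?_))
      · exact ⟨((⟨d, by omega⟩, ⟨j, by omega⟩, ⟨h, by omega⟩, ⟨i, by omega⟩), (μ, ν), false, b), rfl⟩
      · exact ⟨((⟨d, by omega⟩, ⟨j, by omega⟩, ⟨h, by omega⟩, ⟨i, by omega⟩), (μ, ν), true, b), rfl⟩
    rw [matrix_eq_sum_single α]
    simp only [Fin.sum_univ_two, wordFamily_add]
    exact add_mem (add_mem (key _ _) (key _ _)) (add_mem (key _ _) (key _ _))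
  · have : wordFamily N d α b j h i = 0 := by
      funext L
      simp [wordFamily, shift_pow_eq_zero N (not_le.1 hd)]
    rw [this]
    exact zero_mem _

theorem finrank_wordSpan_le (N : ℕ) :
    FiniteDimensional ℝ (wordSpan N) ∧ Module.finrank ℝ (wordSpan N) ≤ 16 * (N + 1) ^ 4 := by
  have hfin : FiniteDimensional ℝ (Submodule.span ℝ (Set.range (wordBasis N))) :=
    FiniteDimensional.span_of_finite ℝ (Set.finite_range _)
  refine ⟨Submodule.finiteDimensional_of_le (wordSpan_le_span_range N), ?_⟩
  refine (Submodule.finrank_mono (wordSpan_le_span_range N)).trans ?_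
  refine (finrank_range_le_card (wordBasis N)).trans ?_
  simp only [Fintype.card_prod, Fintype.card_fin, Fintype.card_bool]
  -- Four indices up to `N`, four matrix units, a factor 1 or i, and a choice of a† or a.
  apply le_of_eq
  ring

theorem wordFamily_mem (N : ℕ) {d : ℕ} (α : Matrix (Fin 2) (Fin 2) ℂ) (b : Bool) {j h i : ℕ}
    (hj : j ≤ d) (hh : h ≤ d) (hi : i ≤ d) : wordFamily N d α b j h i ∈ wordSpan N :=
  Submodule.subset_span ⟨d, α, b, j, h, i, hj, hh, hi, rfl⟩

/-- A generator raises the degree d by one and each of j, h, i by at most one, so the bounds j, h, i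
≤ d persist. -/
theorem skewLadder_mul_mem (N : ℕ) (α : Matrix (Fin 2) (Fin 2) ℂ) {M : ∀ L, BigOp N L}
    (hM : M ∈ wordSpan N) : (fun L => (shift N ⊗ₖ skewLadder L 1 α) * M L) ∈ wordSpan N := by
  induction hM using Submodule.span_induction with
  | mem M hM =>
    obtain ⟨d, β, b, j, h, i, hj, hh, hi, rfl⟩ := hM
    obtain ⟨b1, j1, h1, i1, i1', t1, hj1, hh1, hi1, hi1', e1⟩ :=
      creation_mul_normalForm b hj hh hi
    obtain ⟨b2, j2, h2, i2, i2', t2, hj2, hh2, hi2, hi2', e2⟩ :=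
      annihilation_mul_normalForm b hj hh hi
    have e : (fun L => (shift N ⊗ₖ skewLadder L 1 α) * wordFamily N d β b j h i L) =
        (wordFamily N (d + 1) (Complex.I • (α * β)) b1 j1 h1 i1 +
          t1 • wordFamily N (d + 1) (Complex.I • (α * β)) b1 j1 h1 i1') +
        (wordFamily N (d + 1) (Complex.I • (αᴴ * β)) b2 j2 h2 i2 +
          t2 • wordFamily N (d + 1) (Complex.I • (αᴴ * β)) b2 j2 h2 i2') := by
      funext L
      simp only [wordFamily, Pi.add_apply, Pi.smul_apply, ← mul_kronecker_mul, ← pow_succ',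
        ← kronecker_add, ← kronecker_smul]
      congr 1
      simp only [skewLadder, ladder, pow_one, Matrix.smul_mul, add_mul, tens_mul_tens,
        Matrix.mul_smul, e1, e2]
      simp only [tens_smul_left, tens_smul_right, tens_add_right, ← Complex.coe_smul, smul_add,
        smul_smul, pow_succ]
      module
    rw [e]
    exact add_mem (add_mem (wordFamily_mem N _ _ hj1 hh1 hi1)
      (Submodule.smul_mem _ _ (wordFamily_mem N _ _ hj1 hh1 hi1')))
      (add_mem (wordFamily_mem N _ _ hj2 hh2 hi2)
      (Submodule.smul_mem _ _ (wordFamily_mem N _ _ hj2 hh2 hi2')))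
  | zero =>
    simp only [Pi.zero_apply, mul_zero]
    exact zero_mem _
  | add x y _ _ hx hy =>
    simp only [Pi.add_apply, mul_add]
    exact add_mem hx hy
  | smul c x _ hx =>
    simp only [Pi.smul_apply, Matrix.mul_smul]
    exact Submodule.smul_mem _ c hx

theorem one_mem_wordSpan (N : ℕ) : (fun L => (1 : BigOp N L)) ∈ wordSpan N := by
  have e : (fun L => (1 : BigOp N L)) = wordFamily N 0 1 true 0 0 0 := by
    funext L
    have : normalForm true 0 0 0 L = 1 := by
      ext p q
      have hq : (q : ℕ) ≤ L := Nat.lt_succ_iff.1 q.2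
      by_cases h : p = q <;> simp [normalForm, diagOp, Matrix.one_apply, h, hq]
    simp [wordFamily, this, tens_one_one]
  rw [e]
  exact wordFamily_mem N _ _ le_rfl le_rfl le_rfl

/-- The underlying family of a bounded family, as a linear map. -/
def famCoe (N : ℕ) : Fam N →ₗ[ℝ] ∀ L, BigOp N L where
  toFun f L := f L
  map_add' _ _ := rfl
  map_smul' _ _ := rfl

theorem famCoe_injective (N : ℕ) : Function.Injective (famCoe N) := fun _ _ h => lp.ext h

/-- The bounded families in `wordSpan`. -/
noncomputable def famSpan (N : ℕ) : Submodule ℝ (Fam N) := (wordSpan N).comap (famCoe N)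

theorem finrank_famSpan_le (N : ℕ) :
    FiniteDimensional ℝ (famSpan N) ∧ Module.finrank ℝ (famSpan N) ≤ 16 * (N + 1) ^ 4 := by
  obtain ⟨h1, h2⟩ := finrank_wordSpan_le N
  let ψ : famSpan N →ₗ[ℝ] wordSpan N := (famCoe N).restrict fun _ hz => hz
  have hψ : Function.Injective ψ := fun a b h =>
    Subtype.ext (famCoe_injective N (congrArg (fun z : wordSpan N => (z : ∀ L, BigOp N L)) h))
  exact ⟨Module.Finite.of_injective ψ hψ, (LinearMap.finrank_le_finrank_of_injective hψ).trans h2⟩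

theorem lieSpan_letter_le (N : ℕ) : ExpWord.lieSpan (letter N) ≤ famSpan N := by
  have := (finrank_famSpan_le N).1
  refine ExpWord.lieSpan_le (letter N) (famSpan N) (one_mem_wordSpan N) fun U z hz => ?_
  have h := skewLadder_mul_mem N ((U : Matrix (Fin 2) (Fin 2) ℂ) * sigmaPlus *
      (U : Matrix (Fin 2) (Fin 2) ℂ)ᴴ) (M := famCoe N z) hz
  simp only [← letterOp_eq_skewLadder] at h
  exact h

theorem finrank_lieSpan_letter_le (N : ℕ) : FiniteDimensional ℝ (ExpWord.lieSpan (letter N)) ∧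
    Module.finrank ℝ (ExpWord.lieSpan (letter N)) ≤ 16 * (N + 1) ^ 4 := by
  obtain ⟨h1, h2⟩ := finrank_famSpan_le N
  exact ⟨Submodule.finiteDimensional_of_le (lieSpan_letter_le N),
    (Submodule.finrank_mono (lieSpan_letter_le N)).trans h2⟩

end BosonQubit

/-! ### Ladder operators in the Lie algebra of the letters -/

namespace BosonQubit

open NormedSpace Matrix Truncation
open scoped Kronecker ENNReal

theorem kronecker_sub {m n : Type*} (K : Matrix m m ℂ) (X Y : Matrix n n ℂ) :
    K ⊗ₖ (X - Y) = K ⊗ₖ X - K ⊗ₖ Y := by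
  ext
  simp [mul_sub]

/-- The jet at cutoff `L`. -/
noncomputable abbrev opJet (N L : ℕ) (θ : ℝ) :
    Matrix (Fin (N + 1) × (Fin (L + 1) ⊕ Fin (L + 1))) (Fin (L + 1) ⊕ Fin (L + 1)) ℂ :=
  jet N (Fin (L + 1) ⊕ Fin (L + 1)) θ

/-- The member of a family at cutoff `L`. -/
def famEval {N : ℕ} (f : Fam N) (L : ℕ) : BigOp N L := f L

/-- The family `shift ^ j ⊗ skewLadder` belongs to the Lie algebra of the letters. -/
def LadderReachable (N j : ℕ) (α : Matrix (Fin 2) (Fin 2) ℂ) : Prop :=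
  ∃ z ∈ ExpWord.lieSpan (letter N), ∀ L, z L = (shift N ^ j) ⊗ₖ skewLadder L j α

theorem LadderReachable.add {N j : ℕ} {α β : Matrix (Fin 2) (Fin 2) ℂ}
    (hα : LadderReachable N j α) (hβ : LadderReachable N j β) : LadderReachable N j (α + β) := by
  obtain ⟨y, hy, ey⟩ := hα
  obtain ⟨z, hz, ez⟩ := hβ
  refine ⟨y + z, add_mem hy hz, fun L => ?_⟩
  rw [lp.coeFn_add, Pi.add_apply, ey, ez, ← kronecker_add]
  simp only [skewLadder, ladder_add, smul_add]

theorem LadderReachable.smul {N j : ℕ} {α : Matrix (Fin 2) (Fin 2) ℂ} (c : ℝ)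
    (hα : LadderReachable N j α) : LadderReachable N j ((c : ℂ) • α) := by
  obtain ⟨y, hy, ey⟩ := hα
  refine ⟨c • y, Submodule.smul_mem _ c hy, fun L => ?_⟩
  rw [lp.coeFn_smul, Pi.smul_apply, ey, ← Complex.coe_smul, ← kronecker_smul]
  simp only [skewLadder, ladder_smul]
  rw [smul_comm]

theorem ladderReachable_of_unitary (N : ℕ) {U γ : Matrix (Fin 2) (Fin 2) ℂ} (hU : Uᴴ * U = 1)
    (hγ : U * sigmaPlus * Uᴴ = γ) : LadderReachable N 1 γ := by
  refine ⟨letter N ⟨U, mem_unitaryGroup_iff'.2 hU⟩, ExpWord.letter_mem_lieSpan _ _, fun L => ?_⟩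
  rw [letter_apply, letterOp_eq_skewLadder, pow_one]
  simp only [hγ]

theorem LadderReachable.succ {N j : ℕ} {α β : Matrix (Fin 2) (Fin 2) ℂ}
    (h1 : LadderReachable N j α) (h2 : LadderReachable N j (Complex.I • α))
    (h3 : LadderReachable N 1 β) (h4 : LadderReachable N 1 (-Complex.I • β)) :
    LadderReachable N (j + 1) ((2 * Complex.I) • (α * β - β * α)) := by
  have := (finrank_lieSpan_letter_le N).1
  obtain ⟨y, hy, ey⟩ := h1
  obtain ⟨y', hy', ey'⟩ := h2
  obtain ⟨z, hz, ez⟩ := h3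
  obtain ⟨z', hz', ez'⟩ := h4
  refine ⟨(y * z - z * y) + (y' * z' - z' * y'),
    add_mem (ExpWord.commutator_mem_lieSpan _ hy hz) (ExpWord.commutator_mem_lieSpan _ hy' hz'),
    fun L => ?_⟩
  rw [← skewLadder_commutator]
  change (y L * z L - z L * y L) + (y' L * z' L - z' L * y' L) = _
  rw [ey, ey', ez, ez']
  simp only [← mul_kronecker_mul, ← pow_add, add_comm 1 j, ← kronecker_sub, ← kronecker_add]

/-- The Pauli matrix `Z`. -/
def sigmaZ : Matrix (Fin 2) (Fin 2) ℂ := !![1, 0; 0, -1]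

theorem ladderReachable_sigmaPlus_one (N : ℕ) :
    LadderReachable N 1 sigmaPlus ∧ LadderReachable N 1 (Complex.I • sigmaPlus) := by
  constructor
  · exact ladderReachable_of_unitary N (U := 1) (by simp) (by simp)
  · refine ladderReachable_of_unitary N (U := !![1, 0; 0, -Complex.I]) ?_ ?_
    · ext i j
      fin_cases i <;> fin_cases j <;> simp [Matrix.mul_apply, Fin.sum_univ_two]
    · ext i j
      fin_cases i <;> fin_cases j <;> simp [Matrix.mul_apply, Fin.sum_univ_two, sigmaPlus]

theorem ladderReachable_sigmaZ (N : ℕ) :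
    LadderReachable N 1 sigmaZ ∧ LadderReachable N 1 (-Complex.I • sigmaZ) := by
  obtain ⟨hp, hp'⟩ := ladderReachable_sigmaPlus_one N
  have hm : LadderReachable N 1 !![0, 0; 1, 0] := by
    refine ladderReachable_of_unitary N (U := !![0, 1; 1, 0]) ?_ ?_ <;>
    · ext i j
      fin_cases i <;> fin_cases j <;> simp [Matrix.mul_apply, Fin.sum_univ_two, sigmaPlus]
  have hm' : LadderReachable N 1 !![0, 0; Complex.I, 0] := by
    refine ladderReachable_of_unitary N (U := !![0, -Complex.I; 1, 0]) ?_ ?_ <;>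
    · ext i j
      fin_cases i <;> fin_cases j <;> simp [Matrix.mul_apply, Fin.sum_univ_two, sigmaPlus]
  -- A 3-4-5 rotation gives a conjugate of σ₊ with nonzero diagonal and rational entries; its
  -- off-diagonal part is removed below.
  have hr : LadderReachable N 1 !![-12 / 25, 9 / 25; -16 / 25, 12 / 25] := by
    refine ladderReachable_of_unitary N (U := !![3 / 5, -4 / 5; 4 / 5, 3 / 5]) ?_ ?_ <;>
    · ext i j
      fin_cases i <;> fin_cases j <;>
        simp [Matrix.mul_apply, Fin.sum_univ_two, sigmaPlus, map_ofNat] <;> norm_num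
  have hr' : LadderReachable N 1 (Complex.I • !![-12 / 25, 9 / 25; -16 / 25, 12 / 25]) := by
    refine ladderReachable_of_unitary N
      (U := !![3 / 5, 4 / 5 * Complex.I; 4 / 5, -3 / 5 * Complex.I]) ?_ ?_ <;>
    · ext i j
      fin_cases i <;> fin_cases j <;>
        simp [Matrix.mul_apply, Fin.sum_univ_two, sigmaPlus, map_ofNat] <;> ring_nf <;>
        simp [Complex.I_sq]
  constructor
  · have := ((hr.smul (-25 / 12)).add (hp.smul (3 / 4))).add (hm.smul (-4 / 3))
    convert this using 1
    ext i j
    fin_cases i <;> fin_cases j <;> simp [sigmaZ, sigmaPlus] <;> norm_num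
  · have := ((hr'.smul (25 / 12)).add (hp'.smul (-3 / 4))).add (hm'.smul (4 / 3))
    convert this using 1
    ext i j
    fin_cases i <;> fin_cases j <;> simp [sigmaZ, sigmaPlus] <;> ring

/-- Since [σ₊, Z] = -2σ₊, bracketing with Z raises the degree and keeps the qubit factor up to a
scalar. Carrying σ₊ and iσ₊ together supplies both commutators of the next step. -/
theorem ladderReachable_sigmaPlus (N j : ℕ) : LadderReachable N (j + 1) sigmaPlus ∧
    LadderReachable N (j + 1) (Complex.I • sigmaPlus) := by
  have hI : Complex.I * Complex.I = -1 := Complex.I_mul_I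
  obtain ⟨hz, hz'⟩ := ladderReachable_sigmaZ N
  induction j with
  | zero => exact ladderReachable_sigmaPlus_one N
  | succ j ih =>
    obtain ⟨h1, h2⟩ := ih
    have h3 : LadderReachable N (j + 1) (Complex.I • Complex.I • sigmaPlus) := by
      have := h1.smul (-1)
      rw [smul_smul, hI]
      simpa using this
    constructor
    · have := (h2.succ h3 hz hz').smul (1 / 4)
      convert this using 1
      ext i k
      fin_cases i <;> fin_cases k <;>
        simp [sigmaZ, sigmaPlus]
      linear_combination (1 : ℂ) * hI
    · have := (h1.succ h2 hz hz').smul (-1 / 4)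
      convert this using 1
      ext i k
      fin_cases i <;> fin_cases k <;>
        simp [sigmaZ, sigmaPlus]
      ring

/-! ### From the formal shift to the scale θ -/

theorem norm_exp_le_one_of_skew {n : Type*} [Fintype n] [DecidableEq n] {X : Matrix n n ℂ}
    (h : Xᴴ = -X) : ‖exp X‖ ≤ 1 := by
  let _ : NormedAlgebra ℚ (Matrix n n ℂ) := NormedAlgebra.restrictScalars ℚ ℂ _
  have := exp_mem_unitary_of_mem_skewAdjoint (skewAdjoint.mem_iff.2 h)
  exact norm_le_one_of_conjTranspose_mul_self (Unitary.star_mul_self_of_mem this)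

theorem skewLadder_conjTranspose (L j : ℕ) (α : Matrix (Fin 2) (Fin 2) ℂ) :
    (skewLadder L j α)ᴴ = -skewLadder L j α := by
  rw [skewLadder, conjTranspose_smul, ladder_isHermitian, ← neg_smul]
  congr 1
  simp

theorem norm_skewLadder_sigmaPlus_le (L j : ℕ) : ‖skewLadder L j sigmaPlus‖ ≤ 1 := by
  rw [skewLadder, ← blockHamiltonian_eq_ladder, norm_smul, norm_mul, Complex.norm_I, one_mul,
    norm_pow, Complex.norm_real, Real.norm_of_nonneg (inv_nonneg.2 (Real.sqrt_nonneg _))]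
  calc _ ≤ (Real.sqrt L)⁻¹ ^ j * Real.sqrt L ^ j :=
        mul_le_mul_of_nonneg_left (norm_blockHamiltonian_le L j)
          (pow_nonneg (inv_nonneg.2 (Real.sqrt_nonneg _)) _)
    _ = ((Real.sqrt L)⁻¹ * Real.sqrt L) ^ j := (mul_pow _ _ _).symm
    _ ≤ 1 := pow_le_one₀ (mul_nonneg (inv_nonneg.2 (Real.sqrt_nonneg _)) (Real.sqrt_nonneg _))
        inv_mul_le_one

/-- Evaluation at a cutoff is a continuous ring homomorphism, so one identity between families holds
at every cutoff. -/
theorem exp_fam_apply {N : ℕ} (f : Fam N) (L : ℕ) : famEval (exp f) L = exp (famEval f L) := by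
  let _ : NormedAlgebra ℚ (Fam N) := NormedAlgebra.restrictScalars ℚ ℝ (Fam N)
  let ev : Fam N →+* BigOp N L :=
    { toFun := fun f => famEval f L
      map_one' := rfl
      map_mul' := fun _ _ => rfl
      map_zero' := rfl
      map_add' := fun _ _ => rfl }
  have hc : Continuous ev := by
    refine AddMonoidHomClass.continuous_of_bound ev 1 fun f => ?_
    rw [one_mul]
    exact lp.norm_apply_le_norm (by simp) f L
  exact map_exp ev hc f

/-- A generator of degree `j` is intertwined by the jet with its value at the scale `θ`. -/
theorem exists_norm_exp_mul_jet_le (N j : ℕ) {ρ : ℝ} (hρ : 0 ≤ ρ) :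
    ∃ K : ℝ, 0 ≤ K ∧ ∀ (L : ℕ) (X : Op L) (θ : ℝ), ‖X‖ ≤ ρ → 0 ≤ θ → θ ≤ 1 →
      ‖exp ((shift N ^ j) ⊗ₖ X) * opJet N L θ - opJet N L θ * exp ((θ ^ j) • X)‖ ≤
        K * θ ^ (N + 1) := by
  obtain ⟨C, hC, h⟩ := exists_norm_shift_pow_kronecker_mul_jet_le N j
  set S := ∑ r, ∑ c, ‖(shift N ^ j) r c‖
  have hS : 0 ≤ S := Finset.sum_nonneg fun _ _ => Finset.sum_nonneg fun _ _ => norm_nonneg _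
  -- 1 + ρ + Sρ is at least 1 and bounds the norms of both exponents.
  refine ⟨Real.exp (2 * (1 + ρ + S * ρ)) * (C * ρ), by positivity, fun L X θ hX h0 h1 => ?_⟩
  rw [mul_assoc (Real.exp _)]
  have hSρ : 0 ≤ S * ρ := by positivity
  refine norm_exp_mul_sub_mul_exp_le _ _ _ (by linarith) ?_ ?_ ?_
  · refine (norm_kronecker_le _ _).trans ?_
    have : S * ‖X‖ ≤ S * ρ := mul_le_mul_of_nonneg_left hX hS
    linarith
  · have : ‖(θ ^ j) • X‖ ≤ ‖X‖ := by
      rw [norm_smul, Real.norm_of_nonneg (by positivity)]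
      exact mul_le_of_le_one_left (norm_nonneg _) (pow_le_one₀ h0 h1)
    linarith
  · have := h _ X θ h0 h1
    rw [← Complex.ofReal_pow, Complex.coe_smul] at this
    refine this.trans ?_
    gcongr

/-- The product of the gates of a word at cutoff `L` and scale `θ`. -/
noncomputable def scaledProd (L : ℕ) (θ : ℝ) (w : List (ℝ × Matrix.unitaryGroup (Fin 2) ℂ)) :
    Op L :=
  (w.map fun q => exp ((θ * q.1) • letterOp L q.2)).prod

theorem letterOp_conjTranspose (L : ℕ) (U : Matrix.unitaryGroup (Fin 2) ℂ) :
    (letterOp L U)ᴴ = -letterOp L U := by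
  rw [letterOp_eq_skewLadder, skewLadder_conjTranspose]

theorem norm_exp_smul_le_one {L : ℕ} {X : Op L} (h : Xᴴ = -X) (t : ℝ) : ‖exp (t • X)‖ ≤ 1 :=
  norm_exp_le_one_of_skew (by rw [conjTranspose_smul, h]; simp)

theorem norm_scaledProd_le (L : ℕ) (θ : ℝ) (w : List (ℝ × Matrix.unitaryGroup (Fin 2) ℂ)) :
    ‖scaledProd L θ w‖ ≤ 1 := by
  induction w with
  | nil => simp [scaledProd]
  | cons q w ih =>
    have : scaledProd L θ (q :: w) = exp ((θ * q.1) • letterOp L q.2) * scaledProd L θ w := by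
      simp [scaledProd]
    rw [this]
    refine (norm_mul_le _ _).trans ?_
    exact mul_le_one₀ (norm_exp_smul_le_one (letterOp_conjTranspose L q.2) _) (norm_nonneg _) ih

/-- Gate errors telescope along the word; `K` depends on the word but not on `L`, because the
factors are bounded uniformly in the cutoff. -/
theorem exists_norm_wordProd_mul_jet_le (N : ℕ)
    (w : List (ℝ × Matrix.unitaryGroup (Fin 2) ℂ)) :
    ∃ K : ℝ, 0 ≤ K ∧ ∀ (L : ℕ) (θ : ℝ), 0 ≤ θ → θ ≤ 1 →
      ‖famEval (ExpWord.wordProd (letter N) w) L * opJet N L θ - opJet N L θ * scaledProd L θ w‖ ≤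
        K * θ ^ (N + 1) := by
  induction w with
  | nil =>
    refine ⟨0, le_rfl, fun L θ _ _ => ?_⟩
    have : famEval (ExpWord.wordProd (letter N) []) L = 1 := rfl
    simp [this, scaledProd]
  | cons q w ih =>
    obtain ⟨K, hK, h⟩ := ih
    obtain ⟨K', hK', h'⟩ := exists_norm_exp_mul_jet_le N 1 (abs_nonneg q.1)
    set P := exp (q.1 • letter N q.2)
    refine ⟨‖P‖ * K + K', by positivity, fun L θ h0 h1 => ?_⟩
    set W := ExpWord.wordProd (letter N) w
    set A := exp ((θ * q.1) • letterOp L q.2)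
    have e1 : famEval (ExpWord.wordProd (letter N) (q :: w)) L = famEval P L * famEval W L := by
      rw [ExpWord.wordProd_cons]
      rfl
    have e2 : scaledProd L θ (q :: w) = A * scaledProd L θ w := by simp [scaledProd, A]
    have hA : ‖famEval P L * opJet N L θ - opJet N L θ * A‖ ≤ K' * θ ^ (N + 1) := by
      have hX : ‖q.1 • letterOp L q.2‖ ≤ |q.1| := by
        rw [norm_smul, Real.norm_eq_abs]
        exact mul_le_of_le_one_right (abs_nonneg _) (norm_letterOp_le L q.2)
      have := h' L (q.1 • letterOp L q.2) θ hX h0 h1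
      rw [pow_one, pow_one, smul_smul, kronecker_smul] at this
      rw [show famEval P L = exp (q.1 • (shift N ⊗ₖ letterOp L q.2)) from exp_fam_apply _ L]
      exact this
    have e3 : famEval P L * famEval W L * opJet N L θ - opJet N L θ * (A * scaledProd L θ w) =
        famEval P L * (famEval W L * opJet N L θ - opJet N L θ * scaledProd L θ w) +
          (famEval P L * opJet N L θ - opJet N L θ * A) * scaledProd L θ w := by
      rw [Matrix.mul_sub, Matrix.sub_mul]
      simp only [Matrix.mul_assoc]
      abel
    rw [e1, e2, e3]
    have hP : ‖famEval P L‖ ≤ ‖P‖ := lp.norm_apply_le_norm (by simp) P L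
    calc _ ≤ ‖famEval P L‖ * ‖famEval W L * opJet N L θ - opJet N L θ * scaledProd L θ w‖ +
          ‖famEval P L * opJet N L θ - opJet N L θ * A‖ * ‖scaledProd L θ w‖ :=
          (norm_add_le _ _).trans (add_le_add (l2_opNorm_mul _ _) (l2_opNorm_mul _ _))
      _ ≤ ‖P‖ * (K * θ ^ (N + 1)) + K' * θ ^ (N + 1) * 1 :=
          add_le_add (mul_le_mul hP (h L θ h0 h1) (norm_nonneg _) (norm_nonneg _))
            (mul_le_mul hA (norm_scaledProd_le L θ w) (norm_nonneg _) (by positivity))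
      _ = _ := by ring

/-- Two operators nearly intertwined with the same `G` are close, because the jet has a left inverse
of norm at most 1. -/
theorem norm_sub_le_of_jet {N L : ℕ} {θ δ δ' : ℝ} (G : BigOp N L) {A A' : Op L}
    (h : ‖G * opJet N L θ - opJet N L θ * A‖ ≤ δ) (h' : ‖G * opJet N L θ - opJet N L θ * A'‖ ≤ δ') :
    ‖A - A'‖ ≤ δ + δ' := by
  set ι := opJet N L θ
  set ε := (incl (Fin (L + 1) ⊕ Fin (L + 1)) (0 : Fin (N + 1)))ᴴ
  have e : A - A' = ε * ((G * ι - ι * A') - (G * ι - ι * A)) := by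
    rw [sub_sub_sub_cancel_left, Matrix.mul_sub, ← Matrix.mul_assoc, ← Matrix.mul_assoc,
      incl_zero_conjTranspose_mul_jet, Matrix.one_mul, Matrix.one_mul]
  have hε : ‖ε‖ ≤ 1 := by
    rw [l2_opNorm_conjTranspose]
    exact norm_incl_le _
  rw [e]
  calc _ ≤ ‖ε‖ * ‖(G * ι - ι * A') - (G * ι - ι * A)‖ := l2_opNorm_mul _ _
    _ ≤ 1 * (δ' + δ) := mul_le_mul hε ((norm_sub_le _ _).trans (add_le_add h' h))
        (norm_nonneg _) zero_le_one
    _ = δ + δ' := by ring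

/-- A single word, independent of the cutoff, approximates the target to order `N + 1`. -/
theorem exists_word_approx (N j : ℕ) :
    ∃ u : ℝ, 0 < u ∧ ∃ K : ℝ, 0 ≤ K ∧ ∀ s : ℝ, |s| = 1 →
      ∃ w : List (ℝ × Matrix.unitaryGroup (Fin 2) ℂ),
      w.length ≤ 16 * (N + 1) ^ 4 * (2 * (16 * (N + 1) ^ 4) + 1) ∧
      ∀ (L : ℕ) (θ : ℝ), 0 ≤ θ → θ ≤ 1 →
        ‖exp ((s * u * θ ^ (j + 1)) • skewLadder L (j + 1) sigmaPlus) - scaledProd L θ w‖ ≤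
          K * θ ^ (N + 1) := by
  obtain ⟨hfin, hrank⟩ := finrank_lieSpan_letter_le N
  obtain ⟨z, hz, ez⟩ := (ladderReachable_sigmaPlus N j).1
  obtain ⟨u1, hu1, H1⟩ := ExpWord.exists_wordProd_eq_exp (letter N) hrank hz
  obtain ⟨u2, hu2, H2⟩ := ExpWord.exists_wordProd_eq_exp (letter N) hrank (neg_mem hz)
  -- A single time u for both signs: only two words ever occur, so one `K` serves them all, and θ
  -- carries the dependence on time.
  set u := min u1 u2
  have hu : 0 < u := lt_min hu1 hu2
  obtain ⟨w1, hw1, e1⟩ := H1 u ⟨hu.le, min_le_left _ _⟩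
  obtain ⟨w2, hw2, e2⟩ := H2 u ⟨hu.le, min_le_right _ _⟩
  obtain ⟨K1, hK1, h1⟩ := exists_norm_wordProd_mul_jet_le N w1
  obtain ⟨K2, hK2, h2⟩ := exists_norm_wordProd_mul_jet_le N w2
  obtain ⟨K3, hK3, h3⟩ := exists_norm_exp_mul_jet_le N (j + 1) hu.le
  refine ⟨u, hu, K3 + (K1 + K2), by positivity, fun s hs => ?_⟩
  have key : ∀ L θ, 0 ≤ θ → θ ≤ 1 → ‖famEval (exp ((s * u) • z)) L * opJet N L θ -
      opJet N L θ * exp ((s * u * θ ^ (j + 1)) • skewLadder L (j + 1) sigmaPlus)‖ ≤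
        K3 * θ ^ (N + 1) := by
    intro L θ h0 h1
    have hX : ‖(s * u) • skewLadder L (j + 1) sigmaPlus‖ ≤ u := by
      rw [norm_smul, norm_mul, Real.norm_eq_abs, hs, one_mul, Real.norm_of_nonneg hu.le]
      exact mul_le_of_le_one_right hu.le (norm_skewLadder_sigmaPlus_le L _)
    have := h3 L ((s * u) • skewLadder L (j + 1) sigmaPlus) θ hX h0 h1
    rw [smul_smul, kronecker_smul, ← ez, mul_comm (θ ^ (j + 1))] at this
    rw [exp_fam_apply]
    exact this
  rcases eq_or_eq_neg_of_abs_eq hs with rfl | rfl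
  · refine ⟨w1, hw1, fun L θ h0 hθ => ?_⟩
    have hk := key L θ h0 hθ
    rw [one_mul, e1] at hk
    have := norm_sub_le_of_jet _ hk (h1 L θ h0 hθ)
    rw [one_mul]
    refine this.trans ?_
    have : 0 ≤ K2 * θ ^ (N + 1) := by positivity
    linarith
  · refine ⟨w2, hw2, fun L θ h0 hθ => ?_⟩
    have hk := key L θ h0 hθ
    rw [neg_one_mul, neg_smul, ← smul_neg, e2] at hk
    have := norm_sub_le_of_jet _ hk (h2 L θ h0 hθ)
    rw [neg_one_mul]
    refine this.trans ?_
    have : 0 ≤ K1 * θ ^ (N + 1) := by positivity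
    linarith

end BosonQubit

/-! ### Circuits for words -/

namespace BosonQubit

open NormedSpace Matrix Truncation

theorem qubitOp_mul (L : ℕ) (U V : Matrix (Fin 2) (Fin 2) ℂ) :
    qubitOp L (U * V) = qubitOp L U * qubitOp L V := by
  simp only [qubitOp_eq_tens, tens_mul_tens, one_mul]

theorem qubitOp_one (L : ℕ) : qubitOp L 1 = 1 := tens_one_one

/-- The Pauli matrix `Z` as a unitary. -/
def unitaryZ : Matrix.unitaryGroup (Fin 2) ℂ := ⟨sigmaZ, by
  rw [mem_unitaryGroup_iff']
  ext i j
  fin_cases i <;> fin_cases j <;> simp [sigmaZ, Matrix.mul_apply, Fin.sum_univ_two, star_eq_conjTranspose]⟩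

theorem sigmaZ_mul_self : sigmaZ * sigmaZ = 1 := by
  ext i j
  fin_cases i <;> fin_cases j <;> simp [sigmaZ, Matrix.mul_apply, Fin.sum_univ_two]

theorem S1_eq_target (L : ℕ) (t : ℝ) : S1 L t = target L 1 t := by
  simp [S1, target, blockHamiltonian]

theorem target_eq_exp_smul (L k : ℕ) (t : ℝ) :
    target L k t = exp (t • (Complex.I • blockHamiltonian L k)) := by
  rw [target, ← Complex.coe_smul t, smul_smul, mul_comm]

theorem target_zero (L k : ℕ) : target L k 0 = 1 := by
  simp [target]

theorem norm_target_le (L k : ℕ) (t : ℝ) : ‖target L k t‖ ≤ 1 := by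
  rw [target_eq_exp_smul]
  refine norm_exp_smul_le_one ?_ t
  rw [conjTranspose_smul, blockHamiltonian_eq_ladder, ladder_isHermitian, ← neg_smul]
  simp

theorem target_div_pow (L k : ℕ) (t : ℝ) {r : ℕ} (hr : 1 ≤ r) :
    target L k (t / r) ^ r = target L k t := by
  let _ : NormedAlgebra ℚ (Op L) := NormedAlgebra.restrictScalars ℚ ℝ (Op L)
  have hr' : (r : ℝ) ≠ 0 := by positivity
  rw [target_eq_exp_smul, target_eq_exp_smul, ← NormedSpace.exp_nsmul, ← Nat.cast_smul_eq_nsmul ℝ, smul_smul,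
    mul_div_cancel₀ _ hr']

/-- Z anticommutes with the off-diagonal generator; this supplies negative times although gates
require `s > 0`. -/
theorem qubitOp_sigmaZ_conj_S1 (L : ℕ) (t : ℝ) :
    qubitOp L sigmaZ * S1 L (-t) * qubitOp L sigmaZ = S1 L t := by
  have h : qubitOp L sigmaZ * qubitOp L sigmaZ = 1 := by
    rw [← qubitOp_mul, sigmaZ_mul_self, qubitOp_one]
  rw [S1_eq_target, S1_eq_target, target_eq_exp_smul, target_eq_exp_smul,
    ← ExpWord.exp_smul_conj_of_mul_eq_one h h, neg_smul, ← smul_neg]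
  congr 2
  simp [blockHamiltonian, qubitOp, sigmaZ, fromBlocks_multiply, fromBlocks_smul, fromBlocks_neg]

namespace Circuit

theorem toOp_append (L : ℕ) (V W : Circuit) : Circuit.toOp L (V ++ W) = V.toOp L * W.toOp L := by
  simp [toOp]

theorem s1Count_append (V W : Circuit) : Circuit.s1Count (V ++ W) = V.s1Count + W.s1Count := by
  simp [s1Count]

theorem toOp_repeated (L : ℕ) (W : Circuit) (r : ℕ) : (W.repeated r).toOp L = W.toOp L ^ r := by
  simp [repeated, toOp, List.map_flatten, List.prod_flatten]

theorem s1Count_repeated (W : Circuit) (r : ℕ) : (W.repeated r).s1Count = r * W.s1Count := by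
  simp [repeated, s1Count, List.map_flatten, List.sum_flatten]

theorem norm_toOp_le (L : ℕ) (W : Circuit) : ‖W.toOp L‖ ≤ 1 := by
  induction W with
  | nil => simp [toOp]
  | cons g W ih =>
    have : Circuit.toOp L (g :: W) = g.toOp L * Circuit.toOp L W := by simp [toOp]
    rw [this]
    refine (norm_mul_le _ _).trans (mul_le_one₀ ?_ (norm_nonneg _) ih)
    cases g with
    | s1 s hs => rw [Gate.toOp, S1_eq_target]; exact norm_target_le L 1 s
    | qubit U => exact norm_qubitOp_le L U

end Circuit

theorem exists_circuit_conj_S1 (L : ℕ) (t : ℝ) (U : Matrix.unitaryGroup (Fin 2) ℂ) :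
    ∃ W : Circuit, W.s1Count ≤ 1 ∧ W.toOp L =
      qubitOp L (U : Matrix (Fin 2) (Fin 2) ℂ) * S1 L t *
        qubitOp L ((star U : Matrix.unitaryGroup (Fin 2) ℂ) : Matrix (Fin 2) (Fin 2) ℂ) := by
  rcases lt_trichotomy t 0 with ht | rfl | ht
  · refine ⟨[.qubit U, .qubit unitaryZ, .s1 (-t) (by linarith), .qubit unitaryZ, .qubit (star U)],
      by simp [Circuit.s1Count, Gate.cost], ?_⟩
    rw [← qubitOp_sigmaZ_conj_S1]
    simp only [Circuit.toOp, List.map_cons, List.map_nil, List.prod_cons, List.prod_nil, Gate.toOp,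
      mul_one, mul_assoc]
    rfl
  · refine ⟨[], by simp [Circuit.s1Count], ?_⟩
    have hU : (U : Matrix (Fin 2) (Fin 2) ℂ) *
        ((star U : Matrix.unitaryGroup (Fin 2) ℂ) : Matrix (Fin 2) (Fin 2) ℂ) = 1 :=
      mem_unitaryGroup_iff.1 U.2
    rw [S1_eq_target, target_zero, mul_one, ← qubitOp_mul, hU, qubitOp_one]
    rfl
  · refine ⟨[.qubit U, .s1 t ht, .qubit (star U)], by simp [Circuit.s1Count, Gate.cost], ?_⟩
    simp [Circuit.toOp, Gate.toOp, mul_assoc]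

theorem exp_smul_letterOp (L : ℕ) (c : ℝ) (U : Matrix.unitaryGroup (Fin 2) ℂ) :
    exp (c • letterOp L U) = qubitOp L (U : Matrix (Fin 2) (Fin 2) ℂ) *
      S1 L (c * (Real.sqrt L)⁻¹) *
        qubitOp L ((star U : Matrix.unitaryGroup (Fin 2) ℂ) : Matrix (Fin 2) (Fin 2) ℂ) := by
  have h1 : qubitOp L (U : Matrix (Fin 2) (Fin 2) ℂ) *
      qubitOp L ((star U : Matrix.unitaryGroup (Fin 2) ℂ) : Matrix (Fin 2) (Fin 2) ℂ) = 1 := by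
    rw [← qubitOp_mul, show (U : Matrix (Fin 2) (Fin 2) ℂ) *
      ((star U : Matrix.unitaryGroup (Fin 2) ℂ) : Matrix (Fin 2) (Fin 2) ℂ) = 1 from
      mem_unitaryGroup_iff.1 U.2, qubitOp_one]
  have h2 : qubitOp L ((star U : Matrix.unitaryGroup (Fin 2) ℂ) : Matrix (Fin 2) (Fin 2) ℂ) *
      qubitOp L (U : Matrix (Fin 2) (Fin 2) ℂ) = 1 := by
    rw [← qubitOp_mul, show ((star U : Matrix.unitaryGroup (Fin 2) ℂ) : Matrix (Fin 2) (Fin 2) ℂ) *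
      (U : Matrix (Fin 2) (Fin 2) ℂ) = 1 from mem_unitaryGroup_iff'.1 U.2, qubitOp_one]
  rw [S1_eq_target, target_eq_exp_smul, ← ExpWord.exp_smul_conj_of_mul_eq_one h1 h2, letterOp,
    mul_smul c, mul_comm Complex.I, ← smul_smul, Complex.coe_smul]
  simp only [Matrix.mul_smul, Matrix.smul_mul]

theorem exists_circuit_scaledProd (L : ℕ) (θ : ℝ)
    (w : List (ℝ × Matrix.unitaryGroup (Fin 2) ℂ)) :
    ∃ W : Circuit, W.s1Count ≤ w.length ∧ W.toOp L = scaledProd L θ w := by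
  induction w with
  | nil => exact ⟨[], by simp [Circuit.s1Count], rfl⟩
  | cons q w ih =>
    obtain ⟨W, hW, eW⟩ := ih
    obtain ⟨V, hV, eV⟩ := exists_circuit_conj_S1 L (θ * q.1 * (Real.sqrt L)⁻¹) q.2
    refine ⟨V ++ W, ?_, ?_⟩
    · rw [Circuit.s1Count_append, List.length_cons]
      omega
    · rw [Circuit.toOp_append, eV, eW, ← exp_smul_letterOp]
      simp [scaledProd]

/-! ### The gate budget -/

theorem one_le_sliceBound {n : ℕ} (hn : 1 ≤ n) {p : ℝ} (hp : 1 < p) : 1 ≤ sliceBound n p := by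
  have hn' : (1 : ℝ) ≤ n := by exact_mod_cast hn
  have h1 : (1 : ℝ) ≤ (n : ℝ) ^ (1.6 : ℝ) := Real.one_le_rpow hn' (by norm_num)
  have h2 : (1 : ℝ) ≤ (30 : ℝ) ^ ((n : ℝ) * p) := Real.one_le_rpow (by norm_num) (by positivity)
  have h3 : (1 : ℝ) ≤ (420 : ℝ) ^ ((n : ℝ) ^ 2 * p / 2) :=
    Real.one_le_rpow (by norm_num) (by positivity)
  have h4 : (1 : ℝ) ≤ (6 : ℝ) ^ (Real.logb 2 (n : ℝ) + 1) := by
    refine Real.one_le_rpow (by norm_num) ?_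
    have := Real.logb_nonneg (b := 2) (by norm_num) hn'
    linarith
  exact one_le_mul_of_one_le_of_one_le (one_le_mul_of_one_le_of_one_le
    (one_le_mul_of_one_le_of_one_le h1 h2) h3) h4

/-- Uses 30 ≥ 2^4, 420 ≥ 2^8 and 6^2 ≥ 2^5, the last because log₂ n ≥ 1; the factor n^1.6 is
discarded. -/
theorem two_rpow_le_sliceBound {n : ℕ} (hn : 2 ≤ n) {p : ℝ} (hp : 1 < p) :
    (2 : ℝ) ^ (4 * n * p + 4 * (n : ℝ) ^ 2 * p + 5) ≤ sliceBound n p := by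
  have hn' : (2 : ℝ) ≤ n := by exact_mod_cast hn
  have h1 : (1 : ℝ) ≤ (n : ℝ) ^ (1.6 : ℝ) := Real.one_le_rpow (by linarith) (by norm_num)
  have h2 : (2 : ℝ) ^ (4 * n * p) ≤ (30 : ℝ) ^ ((n : ℝ) * p) := by
    rw [mul_assoc, Real.rpow_mul (by norm_num)]
    exact Real.rpow_le_rpow (by positivity) (by norm_num) (by positivity)
  have h3 : (2 : ℝ) ^ (4 * (n : ℝ) ^ 2 * p) ≤ (420 : ℝ) ^ ((n : ℝ) ^ 2 * p / 2) := by
    rw [show 4 * (n : ℝ) ^ 2 * p = 8 * ((n : ℝ) ^ 2 * p / 2) by ring, Real.rpow_mul (by norm_num)]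
    exact Real.rpow_le_rpow (by positivity) (by norm_num) (by positivity)
  have h4 : (2 : ℝ) ^ (5 : ℝ) ≤ (6 : ℝ) ^ (Real.logb 2 (n : ℝ) + 1) := by
    have hl : (1 : ℝ) ≤ Real.logb 2 n := by
      rw [Real.le_logb_iff_rpow_le (by norm_num) (by linarith)]
      simpa using hn'
    calc (2 : ℝ) ^ (5 : ℝ) ≤ (6 : ℝ) ^ (2 : ℝ) := by norm_num
      _ ≤ _ := Real.rpow_le_rpow_of_exponent_le (by norm_num) (by linarith)
  rw [Real.rpow_add (by norm_num), Real.rpow_add (by norm_num), sliceBound]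
  refine mul_le_mul (mul_le_mul ?_ h3 (by positivity) (by positivity)) h4 (by positivity)
    (by positivity)
  calc _ ≤ 1 * (30 : ℝ) ^ ((n : ℝ) * p) := by rwa [one_mul]
    _ ≤ _ := by gcongr

theorem word_length_le_sliceBound {k : ℕ} (hk : 2 ≤ k) {p : ℝ} (hp : 1 < p) {N : ℕ}
    (hN : (N : ℝ) < k * p) :
    ((16 * (N + 1) ^ 4 * (2 * (16 * (N + 1) ^ 4) + 1) : ℕ) : ℝ) ≤
      sliceBound (numBinaryDigits k) p := by
  set n := numBinaryDigits k
  have hkn : k < 2 ^ n := Nat.lt_base_pow_length_digits (by norm_num)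
  have hn : 2 ≤ n := by
    by_contra h
    have : 2 ^ n ≤ 2 ^ 1 := Nat.pow_le_pow_right (by norm_num) (by omega)
    omega
  refine le_trans ?_ (two_rpow_le_sliceBound hn hp)
  have hn' : (2 : ℝ) ≤ n := by exact_mod_cast hn
  -- N + 1 < k p + 1 ≤ (k + 1) p ≤ 2^n p.
  have hM : ((N + 1 : ℕ) : ℝ) ≤ 2 ^ n * p := by
    have h1 : ((k + 1 : ℕ) : ℝ) ≤ (2 : ℝ) ^ n := by exact_mod_cast hkn
    push_cast at h1 ⊢
    nlinarith
  have h1 : ((16 * (N + 1) ^ 4 * (2 * (16 * (N + 1) ^ 4) + 1) : ℕ) : ℝ) ≤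
      2 ^ 10 * ((N + 1 : ℕ) : ℝ) ^ 8 := by
    have h2 : (1 : ℝ) ≤ ((N + 1 : ℕ) : ℝ) ^ 4 := one_le_pow₀ (by simp)
    push_cast at h2 ⊢
    nlinarith
  have hp8 : p ≤ (2 : ℝ) ^ (2 * (p - 1)) := by
    calc p = (p - 1) + 1 := by ring
      _ ≤ Real.exp (p - 1) := Real.add_one_le_exp _
      _ = Real.exp 1 ^ (p - 1) := (Real.exp_one_rpow _).symm
      _ ≤ ((2 : ℝ) ^ (2 : ℝ)) ^ (p - 1) := by
          refine Real.rpow_le_rpow (Real.exp_pos _).le ?_ (by linarith)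
          have := Real.exp_one_lt_d9
          norm_num
          linarith
      _ = _ := (Real.rpow_mul (by norm_num) _ _).symm
  calc ((16 * (N + 1) ^ 4 * (2 * (16 * (N + 1) ^ 4) + 1) : ℕ) : ℝ)
      ≤ 2 ^ 10 * ((N + 1 : ℕ) : ℝ) ^ 8 := h1
    _ ≤ 2 ^ 10 * ((2 : ℝ) ^ n * (2 : ℝ) ^ (2 * (p - 1))) ^ 8 := by
        gcongr
        exact hM.trans (by gcongr)
    _ = (2 : ℝ) ^ (10 + (n + 2 * (p - 1)) * 8) := by
        rw [← Real.rpow_natCast (2 : ℝ) n, ← Real.rpow_add (by norm_num), ← Real.rpow_natCast _ 8,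
          ← Real.rpow_mul (by norm_num), Real.rpow_add (by norm_num)]
        norm_num
    _ ≤ _ := by
        refine Real.rpow_le_rpow_of_exponent_le (by norm_num) ?_
        -- The gap between the exponents is this product plus 4n² - 4n - 5, which is positive for n
        -- ≥ 2.
        have h2 : 0 ≤ (p - 1) * (4 * n + 4 * (n : ℝ) ^ 2 - 16) :=
          mul_nonneg (by linarith) (by nlinarith)
        nlinarith

/-! ### One slice and the number of slices -/

theorem scaledTime_nonneg (L k : ℕ) (t : ℝ) : 0 ≤ scaledTime L k t := by
  unfold scaledTime
  positivity

theorem scaledTime_eq (L k : ℕ) (t : ℝ) : scaledTime L k t = Real.sqrt L ^ k * |t| := by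
  rw [scaledTime, Real.sqrt_eq_rpow, ← Real.rpow_natCast, ← Real.rpow_mul (Nat.cast_nonneg _)]
  congr 2
  ring

theorem exp_smul_skewLadder_eq_target {L : ℕ} (hL : 1 ≤ L) (k : ℕ) (τ : ℝ) :
    exp ((τ * Real.sqrt L ^ k) • skewLadder L k sigmaPlus) = target L k τ := by
  have hs : Real.sqrt L ≠ 0 := (Real.sqrt_pos.2 (by exact_mod_cast hL)).ne'
  rw [target, skewLadder, ← blockHamiltonian_eq_ladder, ← Complex.coe_smul, smul_smul]
  congr 2
  have hs' : (Real.sqrt L : ℂ) ≠ 0 := by exact_mod_cast hs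
  push_cast
  field_simp
  rw [mul_assoc, ← mul_pow, mul_one_div_cancel hs', one_pow, mul_one]

/-- One slice: a circuit within the gate budget whose error is of order `p` in the scaled time. -/
theorem exists_slice (k : ℕ) (hk : 1 ≤ k) (p : ℝ) (hp : 1 < p) :
    ∃ K : ℝ, 0 < K ∧ ∀ (L : ℕ) (τ : ℝ), ∃ W : Circuit, 1 ≤ L →
      (W.s1Count : ℝ) ≤ sliceBound (numBinaryDigits k) p ∧
      ‖target L k τ - W.toOp L‖ ≤ K * scaledTime L k τ ^ p := by
  have hn : 1 ≤ numBinaryDigits k := by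
    rw [numBinaryDigits, Nat.one_le_iff_ne_zero, Ne, List.length_eq_zero_iff,
      Nat.digits_eq_nil_iff_eq_zero]
    omega
  have hB := one_le_sliceBound hn hp
  rcases hk.eq_or_lt with rfl | hk2
  · refine ⟨1, one_pos, fun L τ => ?_⟩
    obtain ⟨W, hW, eW⟩ := exists_circuit_conj_S1 L τ 1
    refine ⟨W, fun _ => ⟨le_trans (by exact_mod_cast hW) hB, ?_⟩⟩
    have : W.toOp L = target L 1 τ := by
      rw [eW, S1_eq_target]
      simp [qubitOp_one]
    rw [this, sub_self, norm_zero, one_mul]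
    exact Real.rpow_nonneg (scaledTime_nonneg _ _ _) _
  · obtain ⟨j, rfl⟩ : ∃ j, k = j + 1 := ⟨k - 1, by omega⟩
    set k := j + 1
    have hkp : 0 < (k : ℝ) * p := by positivity
    have hceil : 0 < ⌈(k : ℝ) * p⌉₊ := Nat.ceil_pos.2 hkp
    -- N + 1 = ⌈k p⌉ is the least order that makes θ^(N+1) ≤ θ^(k p) for all θ ≤ 1.
    obtain ⟨N, hN⟩ : ∃ N, ⌈(k : ℝ) * p⌉₊ = N + 1 := ⟨_, (Nat.succ_pred_eq_of_pos hceil).symm⟩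
    have hN1 : (N : ℝ) < k * p := by
      have := Nat.ceil_lt_add_one hkp.le
      rw [hN] at this
      push_cast at this
      linarith
    have hN2 : (k : ℝ) * p ≤ (N + 1 : ℕ) := by
      rw [← hN]
      exact Nat.le_ceil _
    obtain ⟨u, hu, K, hK, hw⟩ := exists_word_approx N j
    -- The extra 2 pays for the regime θ > 1, where the empty circuit has error at most 2.
    refine ⟨(K + 2) / u ^ p, by positivity, fun L τ => ?_⟩
    set σ := scaledTime L k τ
    have hσ : 0 ≤ σ := scaledTime_nonneg _ _ _
    -- Chosen so that u θ^k = σ, the scaled time; then θ^(k p) = (σ/u)^p is the required order.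
    set θ := (σ / u) ^ ((k : ℝ)⁻¹)
    have hσu : 0 ≤ σ / u := by positivity
    have hθ0 : 0 ≤ θ := Real.rpow_nonneg hσu _
    have hk0 : (k : ℝ) ≠ 0 := by positivity
    have hθk : θ ^ k = σ / u := Real.rpow_inv_natCast_pow hσu (by omega)
    have hθp : θ ^ ((k : ℝ) * p) = (σ / u) ^ p := by
      rw [Real.rpow_mul hθ0, Real.rpow_natCast, hθk]
    have hfin : (K + 2) / u ^ p * σ ^ p = (K + 2) * θ ^ ((k : ℝ) * p) := by
      rw [hθp, Real.div_rpow hσ hu.le]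
      ring
    rcases le_or_gt θ 1 with h1 | h1
    · set s : ℝ := if 0 ≤ τ then 1 else -1
      have hs : |s| = 1 := by
        simp only [s]
        split_ifs <;> simp
      have hsτ : s * |τ| = τ := by
        simp only [s]
        split_ifs with h
        · rw [one_mul, abs_of_nonneg h]
        · rw [neg_one_mul, abs_of_neg (not_le.1 h), neg_neg]
      obtain ⟨w, hlen, happ⟩ := hw s hs
      obtain ⟨W, hW, eW⟩ := exists_circuit_scaledProd L θ w
      refine ⟨W, fun hL => ⟨?_, ?_⟩⟩
      · refine le_trans ?_ (word_length_le_sliceBound hk2 hp hN1)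
        exact_mod_cast hW.trans hlen
      · have e : s * u * θ ^ (j + 1) = τ * Real.sqrt L ^ k := by
          rw [show θ ^ (j + 1) = σ / u from hθk, mul_assoc, mul_div_cancel₀ _ hu.ne',
            show σ = Real.sqrt L ^ k * |τ| from scaledTime_eq L k τ]
          linear_combination (Real.sqrt L ^ k) * hsτ
        have h := happ L θ hθ0 h1
        rw [e, exp_smul_skewLadder_eq_target hL, ← eW] at h
        refine h.trans ?_
        rw [hfin]
        have hle : θ ^ (N + 1) ≤ θ ^ ((k : ℝ) * p) := by
          rcases hθ0.eq_or_lt with h0 | h0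
          · rw [← h0, zero_pow (by omega), Real.zero_rpow hkp.ne']
          · rw [← Real.rpow_natCast]
            exact Real.rpow_le_rpow_of_exponent_ge h0 h1 hN2
        have : 0 ≤ θ ^ ((k : ℝ) * p) := Real.rpow_nonneg hθ0 _
        nlinarith
    · refine ⟨[], fun hL => ⟨?_, ?_⟩⟩
      · simp only [Circuit.s1Count, List.map_nil, List.sum_nil, Nat.cast_zero]
        linarith
      · rw [hfin]
        have h2 : (1 : ℝ) ≤ θ ^ ((k : ℝ) * p) := Real.one_le_rpow h1.le hkp.le
        have h3 : ‖target L k τ - Circuit.toOp L []‖ ≤ 2 :=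
          (norm_sub_le _ _).trans (by
            linarith [norm_target_le L k τ, Circuit.norm_toOp_le L []])
        nlinarith

theorem norm_pow_sub_pow_le {R : Type*} [NormedRing R] [NormOneClass R] {A B : R} (hA : ‖A‖ ≤ 1)
    (hB : ‖B‖ ≤ 1) (r : ℕ) : ‖A ^ r - B ^ r‖ ≤ r * ‖A - B‖ := by
  induction r with
  | zero => simp
  | succ r ih =>
    have e : A ^ (r + 1) - B ^ (r + 1) = A * (A ^ r - B ^ r) + (A - B) * B ^ r := by
      rw [pow_succ', pow_succ']
      noncomm_ring
    have hBr : ‖B ^ r‖ ≤ 1 := (norm_pow_le B r).trans (pow_le_one₀ (norm_nonneg _) hB)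
    rw [e]
    calc _ ≤ ‖A‖ * ‖A ^ r - B ^ r‖ + ‖A - B‖ * ‖B ^ r‖ :=
          (norm_add_le _ _).trans (add_le_add (norm_mul_le _ _) (norm_mul_le _ _))
      _ ≤ 1 * (r * ‖A - B‖) + ‖A - B‖ * 1 := by gcongr
      _ = _ := by push_cast; ring

/-- The choice of the number of slices. -/
theorem exists_slice_count {K p : ℝ} (hK : 0 < K) (hp : 1 < p) :
    ∃ β : ℝ, 0 < β ∧ ∀ σ ε : ℝ, 0 ≤ σ → 0 < ε →
      ∃ r : ℕ, 1 ≤ r ∧ β * (σ ^ (1 + 1 / (p - 1)) / ε ^ (1 / (p - 1))) ≤ r ∧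
        (r : ℝ) ≤ max 1 (2 * β * (σ ^ (1 + 1 / (p - 1)) / ε ^ (1 / (p - 1)))) ∧
        r * (K * (σ / r) ^ p) ≤ ε := by
  have hp1 : 0 < p - 1 := by linarith
  -- The condition r K (σ/r)^p ≤ ε means r^(p-1) ≥ K σ^p / ε, that is, r ≥ K^(1/(p-1)) x.
  refine ⟨K ^ (1 / (p - 1)), by positivity, fun σ ε hσ hε => ?_⟩
  set β := K ^ (1 / (p - 1))
  set x := σ ^ (1 + 1 / (p - 1)) / ε ^ (1 / (p - 1))
  have hx : 0 ≤ β * x := by positivity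
  have hr1 : β * x ≤ (max 1 ⌈β * x⌉₊ : ℕ) :=
    (Nat.le_ceil _).trans (by exact_mod_cast le_max_right _ _)
  refine ⟨max 1 ⌈β * x⌉₊, le_max_left _ _, hr1, ?_, ?_⟩
  -- Rounding up at most doubles a number above 1; below 1 a single slice is taken.
  · rcases le_or_gt (β * x) 1 with h | h
    · have : ⌈β * x⌉₊ ≤ 1 := Nat.ceil_le.2 (by simpa using h)
      rw [max_eq_left this]
      simp
    · have h2 := Nat.ceil_lt_add_one hx
      have h3 : 1 ≤ ⌈β * x⌉₊ := Nat.one_le_ceil_iff.2 (by linarith)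
      rw [max_eq_right h3]
      refine le_max_of_le_right ?_
      linarith
  · set r : ℕ := max 1 ⌈β * x⌉₊
    have hr : (0 : ℝ) < r := by
      have : 1 ≤ r := le_max_left _ _
      exact_mod_cast this
    have hpow : K * σ ^ p / ε ≤ (r : ℝ) ^ (p - 1) := by
      have e : (β * x) ^ (p - 1) = K * σ ^ p / ε := by
        rw [Real.mul_rpow (by positivity) (by positivity), Real.div_rpow (by positivity)
          (by positivity), ← Real.rpow_mul hK.le, ← Real.rpow_mul hσ, ← Real.rpow_mul hε.le,
          show 1 / (p - 1) * (p - 1) = 1 by field_simp,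
          show (1 + 1 / (p - 1)) * (p - 1) = p by field_simp; ring, Real.rpow_one, Real.rpow_one,
          mul_div_assoc]
      rw [← e]
      exact Real.rpow_le_rpow hx hr1 hp1.le
    rw [Real.div_rpow hσ hr.le, show (r : ℝ) ^ p = r * r ^ (p - 1) by
      rw [← Real.rpow_one_add' hr.le (by linarith)]; congr 1; ring]
    have hq : 0 < (r : ℝ) ^ (p - 1) := Real.rpow_pos_of_pos hr _
    rw [div_le_iff₀ hε] at hpow
    rw [show (r : ℝ) * (K * (σ ^ p / (r * r ^ (p - 1)))) = K * σ ^ p / r ^ (p - 1) by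
      field_simp, div_le_iff₀ hq]
    linarith

end BosonQubit

/-! ### Assembly -/

theorem mainTheorem1 (k : ℕ) (hk : 1 ≤ k) (p : ℝ) (hp : 1 < p) :
    ∃ W : ℕ → ℝ → BosonQubit.Circuit,
      -- each slice uses at most the stated number of `S_1` gates
      (∀ L : ℕ, 1 ≤ L → ∀ τ : ℝ,
        ((W L τ).s1Count : ℝ) ≤ BosonQubit.sliceBound (BosonQubit.numBinaryDigits k) p) ∧
      -- the slices approximate the target to order `p`
      (∃ K : ℝ, ∀ L : ℕ, 1 ≤ L → ∀ τ : ℝ,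
        ‖BosonQubit.target L k τ - (W L τ).toOp L‖ ≤ K * BosonQubit.scaledTime L k τ ^ p) ∧
      -- `r` slices, with `r` of the stated size, give error at most `ε`
      (∃ c C : ℝ, 0 < c ∧ 0 < C ∧
        ∀ L : ℕ, 1 ≤ L → ∀ t ε : ℝ, 0 < ε →
          ∃ r : ℕ, 1 ≤ r ∧
            c * BosonQubit.sliceScale L k t p ε ≤ (r : ℝ) ∧
            (r : ℝ) ≤ max 1 (C * BosonQubit.sliceScale L k t p ε) ∧
            ‖BosonQubit.target L k t - ((W L (t / r)).repeated r).toOp L‖ ≤ ε ∧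
            ((((W L (t / r)).repeated r).s1Count : ℕ) : ℝ) ≤
              (r : ℝ) * BosonQubit.sliceBound (BosonQubit.numBinaryDigits k) p) := by
  obtain ⟨K, hK, h⟩ := BosonQubit.exists_slice k hk p hp
  choose W hW using h
  obtain ⟨β, hβ, hcount⟩ := BosonQubit.exists_slice_count hK hp
  refine ⟨W, fun L hL τ => (hW L τ hL).1, ⟨K, fun L hL τ => (hW L τ hL).2⟩,
    β, 2 * β, hβ, by positivity, fun L hL t ε hε => ?_⟩
  obtain ⟨r, hr, hr1, hr2, hr3⟩ := hcount _ ε (BosonQubit.scaledTime_nonneg L k t) hε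
  refine ⟨r, hr, hr1, hr2, ?_, ?_⟩
  -- The target at t is the r-th power of the target at t/r, and all operators are contractions, so
  -- the r slice errors add.
  · rw [BosonQubit.Circuit.toOp_repeated, ← BosonQubit.target_div_pow L k t hr]
    refine (BosonQubit.norm_pow_sub_pow_le (BosonQubit.norm_target_le _ _ _)
      (BosonQubit.Circuit.norm_toOp_le _ _) r).trans (le_trans ?_ hr3)
    have e : BosonQubit.scaledTime L k (t / r) = BosonQubit.scaledTime L k t / r := by
      rw [BosonQubit.scaledTime, BosonQubit.scaledTime, abs_div, Nat.abs_cast, mul_div_assoc]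
    rw [← e]
    exact mul_le_mul_of_nonneg_left (hW L _ hL).2 (Nat.cast_nonneg _)
  · rw [BosonQubit.Circuit.s1Count_repeated]
    push_cast
    exact mul_le_mul_of_nonneg_left (hW L _ hL).1 (Nat.cast_nonneg _)
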